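/- Let $\mathcal C$ be a regular category (finite limits, coequalizers of kernel pairs, regular epimorphisms stable under pullback). Write $\mathrm{Rel}(\mathcal C)$ for its category of relations: objects are those of $\mathcal C$, morphisms $A\to B$ are subobjects $R\rightarrowtail A\times B$, composed by taking the image of the pullback; its dagger is the opposite relation, and its tensor product is induced by $\times$. A relation $R$ on $A$ is positive if $R=S^\dagger\circ S$ for some relation $S\colon A\to X$. Call $\mathcal C$ *Mal'cev* if every reflexive relation $R\rightarrowtail A\times A$ is an equivalence relation, and *positively regular* if every reflexive symmetric relation in $\mathcal C$ is positive. Let $\mathrm{CP}(\mathrm{Rel}(\mathcal C))$ be the category whose objects are the special dagger Frobenius structures $(A,\mu,\eta)$ in $\mathrm{Rel}(\mathcal C)$ and whose morphisms $(A,\mu_A,\eta_A)\to(B,\mu_B,\eta_B)$ are the completely positive relations, i.e. those $R\colon A\to B$ whose Choi matrix $(1_A\otimes\mu_B)\circ(1_A\otimes R\otimes 1_B)\circ(\mu_A^\dagger\otimes 1_B)$ is positive. Let $\mathrm{Gpd}(\mathcal C)$ and $\mathrm{Cat}(\mathcal C)$ be the categories of internal groupoids and internal categories in $\mathcal C$,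 with internal functors as morphisms; write $G_1$ for the object of morphisms of $G$. Let $\mathrm{InvRel}(\mathcal C)$ be the category whose objects are the internal groupoids in $\mathcal C$ and whose morphisms $G\to H$ are the relations $R\rightarrowtail G_1\times H_1$ that respect inverses: in the internal logic, $R(a,b)\Rightarrow R(a^{-1},b^{-1})\wedge R(\mathrm{id}_{\mathrm{dom}\,a},\mathrm{id}_{\mathrm{dom}\,b})$. **Theorem.** 1. Every regular Mal'cev category is positively regular. 2. Let $\mathcal C$ be positively regular. Then every relation between internal groupoids that respects inverses is completely positive between the corresponding Frobenius structures, and the functor $E\colon\mathrm{InvRel}(\mathcal C)\to\mathrm{CP}(\mathrm{Rel}(\mathcal C))$ sending $G$ to the Frobenius structure on $G_1$ whose multiplication and unit are the composition and the identities of $G$, and a relation to itself, is an equivalence. Moreover, $\mathcal C$ is Mal'cev if and only if the following hold: - the categories $\mathrm{Gpd}(\mathcal C)$ and $\mathrm{Cat}(\mathcal C)$ are regular, so that $\mathrm{Rel}(\mathrm{Gpd}(\mathcal C))$ and $\mathrm{Rel}(\mathrm{Cat}(\mathcal C))$ are defined; - sending a relation $R\rightarrowtail G\times H$ in $\mathrm{Gpd}(\mathcal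 C)$ to its underlying relation between $G_1$ and $H_1$ (the image of $R_1\to G_1\times H_1$) gives a well-defined functor $U\colon\mathrm{Rel}(\mathrm{Gpd}(\mathcal C))\to\mathrm{InvRel}(\mathcal C)$, and $E\circ U$ is an equivalence $\mathrm{Rel}(\mathrm{Gpd}(\mathcal C))\simeq\mathrm{CP}(\mathrm{Rel}(\mathcal C))$; - the forgetful functor $\mathrm{Gpd}(\mathcal C)\to\mathrm{Cat}(\mathcal C)$, applied to spans representing relations and followed by taking images, induces a well-defined functor $\mathrm{Rel}(\mathrm{Gpd}(\mathcal C))\to\mathrm{Rel}(\mathrm{Cat}(\mathcal C))$, and this functor is an equivalence. -/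

import Mathlib

open CategoryTheory CategoryTheory.Limits

universe v u v' u'

noncomputable section

namespace CPRel

attribute [local simp] prod.lift_fst prod.lift_snd prod.lift_fst_assoc prod.lift_snd_assoc
  prod.comp_lift prod.map_fst prod.map_snd prod.map_fst_assoc prod.map_snd_assoc
  pullback.lift_fst pullback.lift_snd pullback.lift_fst_assoc pullback.lift_snd_assoc

/-! ### Internal relations -/

lemma mk_factors_iff_exists {C : Type u} [Category.{v} C] {X Y T : C} (m : X ⟶ Y) [Mono m]
    (f : T ⟶ Y) : (Subobject.mk m).Factors f ↔ ∃ g : T ⟶ X, g ≫ m = f :=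
  Subobject.mk_factors_iff m f

section FiniteLimits

variable {C : Type u} [Category.{v} C] [HasFiniteLimits C]

/-- A relation from `A` to `B` is a subobject of `A ⨯ B`. -/
abbrev IntRel (A B : C) : Type (max u v) := Subobject (A ⨯ B)

namespace IntRel

/-- The first leg of the jointly monic span representing a relation. -/
def fst {A B : C} (R : IntRel A B) : (R : C) ⟶ A := R.arrow ≫ prod.fst

/-- The second leg of the jointly monic span representing a relation. -/
def snd {A B : C} (R : IntRel A B) : (R : C) ⟶ B := R.arrow ≫ prod.snd

/-- `IntRel.Holds R a b` is the statement `R(a, b)` of the internal logic, for generalized elements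
`a` and `b` of stage `T`. -/
def Holds {A B : C} (R : IntRel A B) {T : C} (a : T ⟶ A) (b : T ⟶ B) : Prop :=
  Subobject.Factors R (prod.lift a b)

/-- The opposite relation: `R†(b, a)` if and only if `R(a, b)`. -/
def dagger {A B : C} (R : IntRel A B) : IntRel B A :=
  (Subobject.pullback (prod.lift prod.snd prod.fst)).obj R

/-- The product of two relations: `(R ⊗ S)((a, a'), (b, b'))` iff `R(a, b)` and `S(a', b')`. -/
def tensor {A A' B B' : C} (R : IntRel A B) (S : IntRel A' B') : IntRel (A ⨯ A') (B ⨯ B') :=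
  (Subobject.pullback (prod.map prod.fst prod.fst)).obj R ⊓
    (Subobject.pullback (prod.map prod.snd prod.snd)).obj S

/-- The graph of a morphism. -/
def graph {A B : C} (f : A ⟶ B) : IntRel A B := Subobject.mk (prod.lift (𝟙 A) f)

/-- The identity relation, given by the diagonal. -/
def ident (A : C) : IntRel A A := graph (𝟙 A)

/-- `R` is reflexive: `R(a, a)` holds for the generic element `a` of `A`. -/
def Reflexive {A : C} (R : IntRel A A) : Prop := R.Holds (𝟙 A) (𝟙 A)

/-- `R` is symmetric: `R(a, b) ⇔ R(b, a)`. -/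
def Symmetric {A : C} (R : IntRel A A) : Prop :=
  ∀ ⦃T : C⦄ (a b : T ⟶ A), R.Holds a b ↔ R.Holds b a

/-- `R` is transitive: `R(a, b) ∧ R(b, c) ⇒ R(a, c)`. -/
def Transitive {A : C} (R : IntRel A A) : Prop :=
  ∀ ⦃T : C⦄ (a b c : T ⟶ A), R.Holds a b → R.Holds b c → R.Holds a c

lemma le_iff {A B : C} {R S : IntRel A B} :
    R ≤ S ↔ ∀ ⦃T : C⦄ (a : T ⟶ A) (b : T ⟶ B), R.Holds a b → S.Holds a b := by
  constructor
  · intro h T a b hab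
    exact Subobject.factors_of_le _ h hab
  · intro h
    apply Subobject.le_of_factors
    have := h R.fst R.snd
    have e : prod.lift R.fst R.snd = R.arrow := by
      ext <;> simp [fst, snd]
    unfold Holds at this
    rw [e] at this
    exact this (Subobject.factors_self R)

lemma ext_holds {A B : C} {R S : IntRel A B}
    (h : ∀ ⦃T : C⦄ (a : T ⟶ A) (b : T ⟶ B), R.Holds a b ↔ S.Holds a b) : R = S :=
  le_antisymm (le_iff.2 fun _ a b => (h a b).1) (le_iff.2 fun _ a b => (h a b).2)

lemma Holds.pull {A B : C} {R : IntRel A B} {T : C} {a : T ⟶ A} {b : T ⟶ B} (h : R.Holds a b)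
    {T' : C} (p : T' ⟶ T) : R.Holds (p ≫ a) (p ≫ b) := by
  unfold Holds at *
  rw [← prod.comp_lift]
  exact Subobject.factors_of_factors_right _ h

lemma dagger_holds {A B : C} (R : IntRel A B) {T : C} (b : T ⟶ B) (a : T ⟶ A) :
    (dagger R).Holds b a ↔ R.Holds a b := by
  unfold Holds dagger
  rw [pullback_factors_iff]
  simp [prod.comp_lift]

lemma tensor_holds {A A' B B' : C} (R : IntRel A B) (S : IntRel A' B') {T : C}
    (a : T ⟶ A ⨯ A') (b : T ⟶ B ⨯ B') :
    (tensor R S).Holds a b ↔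
      R.Holds (a ≫ prod.fst) (b ≫ prod.fst) ∧ S.Holds (a ≫ prod.snd) (b ≫ prod.snd) := by
  unfold Holds tensor
  rw [Subobject.inf_factors, pullback_factors_iff, pullback_factors_iff]
  simp

lemma graph_holds {A B : C} (f : A ⟶ B) {T : C} (a : T ⟶ A) (b : T ⟶ B) :
    (graph f).Holds a b ↔ a ≫ f = b := by
  unfold Holds graph
  rw [mk_factors_iff_exists]
  constructor
  · rintro ⟨g, hg⟩
    have h1 := congrArg (· ≫ prod.fst) hg
    have h2 := congrArg (· ≫ prod.snd) hg
    simp at h1 h2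
    rw [← h1, h2]
  · rintro rfl
    exact ⟨a, by simp [prod.comp_lift]⟩

lemma ident_holds {A : C} {T : C} (a b : T ⟶ A) : (ident A).Holds a b ↔ a = b := by
  simp [ident, graph_holds]

end IntRel

variable (C) in
/-- A category with finite limits is a Mal'cev category if every reflexive relation in it is an
equivalence relation. -/
def IsMalcev : Prop :=
  ∀ ⦃A : C⦄ (R : IntRel A A), R.Reflexive → R.Symmetric ∧ R.Transitive

end FiniteLimits

/-! ### The category of relations in a regular category -/

section RegularCategory

variable {C : Type u} [Category.{v} C] [Regular C]

namespace IntRel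

/-- The relation represented by a span: the image of `⟨f, g⟩ : X ⟶ A ⨯ B`. -/
def ofSpan {X A B : C} (f : X ⟶ A) (g : X ⟶ B) : IntRel A B := imageSubobject (prod.lift f g)

/-- Composition of relations (in diagrammatic order): the image in `A ⨯ D` of the pullback
of `R` and `S` over `B`. -/
def comp {A B D : C} (R : IntRel A B) (S : IntRel B D) : IntRel A D :=
  ofSpan (pullback.fst R.snd S.fst ≫ R.fst) (pullback.snd R.snd S.fst ≫ S.snd)

/-- A relation is positive if it is of the form `S† ∘ S`. -/
def IsPositive {A : C} (R : IntRel A A) : Prop :=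
  ∃ (X : C) (S : IntRel A X), R = comp S (dagger S)

lemma Holds.descend {A B : C} {R : IntRel A B} {T T' : C} (p : T' ⟶ T) [IsRegularEpi p]
    {a : T ⟶ A} {b : T ⟶ B} (h : R.Holds (p ≫ a) (p ≫ b)) : R.Holds a b := by
  unfold Holds at *
  rw [← prod.comp_lift] at h
  have sq : CommSq (Subobject.factorThru R _ h) p R.arrow (prod.lift a b) := ⟨by simp⟩
  exact (Subobject.factors_iff _ _).2 ⟨sq.lift, sq.fac_right⟩

lemma isRegularEpi_comp {X Y Z : C} (f : X ⟶ Y) (g : Y ⟶ Z) [IsRegularEpi f] [IsRegularEpi g] :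
    IsRegularEpi (f ≫ g) := inferInstance

lemma ofSpan_holds {X A B : C} (f : X ⟶ A) (g : X ⟶ B) {T : C} (a : T ⟶ A) (b : T ⟶ B) :
    (ofSpan f g).Holds a b ↔ ∃ (T' : C) (p : T' ⟶ T) (_ : IsRegularEpi p) (x : T' ⟶ X),
      x ≫ f = p ≫ a ∧ x ≫ g = p ≫ b := by
  constructor
  · intro h
    obtain ⟨k, hk⟩ : ∃ k : T ⟶ (imageSubobject (prod.lift f g) : C),
        k ≫ (imageSubobject (prod.lift f g)).arrow = prod.lift a b :=
      ⟨Subobject.factorThru _ _ h, Subobject.factorThru_arrow _ _ _⟩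
    have hse : StrongEpi (factorThruImageSubobject (prod.lift f g)) := by
      unfold factorThruImageSubobject
      infer_instance
    have hre : IsRegularEpi (factorThruImageSubobject (prod.lift f g)) := inferInstance
    have w' : pullback.fst k (factorThruImageSubobject (prod.lift f g)) ≫ prod.lift a b =
        pullback.snd k (factorThruImageSubobject (prod.lift f g)) ≫ prod.lift f g := by
      rw [← hk, ← Category.assoc, pullback.condition, Category.assoc,
        imageSubobject_arrow_comp]
    refine ⟨_, pullback.fst k (factorThruImageSubobject (prod.lift f g)), inferInstance,
      pullback.snd _ _, ?_, ?_⟩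
    · simpa using (congrArg (· ≫ prod.fst) w').symm
    · simpa using (congrArg (· ≫ prod.snd) w').symm
  · rintro ⟨T', p, hp, x, h1, h2⟩
    apply Holds.descend p
    unfold Holds ofSpan
    rw [← h1, ← h2, ← prod.comp_lift]
    exact imageSubobject_factors_comp_self _ _

lemma ofSpan_holds_of_jointly_mono {X A B : C} (f : X ⟶ A) (g : X ⟶ B)
    (hfg : ∀ ⦃T : C⦄ (x y : T ⟶ X), x ≫ f = y ≫ f → x ≫ g = y ≫ g → x = y)
    {T : C} (a : T ⟶ A) (b : T ⟶ B) :
    (ofSpan f g).Holds a b ↔ ∃ x : T ⟶ X, x ≫ f = a ∧ x ≫ g = b := by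
  have : Mono (prod.lift f g) := by
    constructor
    intro T x y h
    apply hfg
    · simpa using congrArg (· ≫ prod.fst) h
    · simpa using congrArg (· ≫ prod.snd) h
  unfold Holds ofSpan
  rw [imageSubobject_mono, mk_factors_iff_exists]
  constructor
  · rintro ⟨x, hx⟩
    exact ⟨x, by simpa using congrArg (· ≫ prod.fst) hx, by simpa using congrArg (· ≫ prod.snd) hx⟩
  · rintro ⟨x, rfl, rfl⟩
    exact ⟨x, by simp [prod.comp_lift]⟩

lemma holds_iff_exists {A B : C} (R : IntRel A B) {T : C} (a : T ⟶ A) (b : T ⟶ B) :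
    R.Holds a b ↔ ∃ x : T ⟶ (R : C), x ≫ R.fst = a ∧ x ≫ R.snd = b := by
  unfold Holds fst snd
  constructor
  · intro h
    exact ⟨Subobject.factorThru _ _ h, by simp [← Category.assoc], by simp [← Category.assoc]⟩
  · rintro ⟨x, rfl, rfl⟩
    have : prod.lift (x ≫ R.arrow ≫ prod.fst) (x ≫ R.arrow ≫ prod.snd) = x ≫ R.arrow := by
      ext <;> simp
    rw [this]
    exact Subobject.factors_comp_arrow x

/-- Composition in the internal logic: `(S ∘ R)(a, d)` iff there is `b` with `R(a, b)` and
`S(b, d)`, where the existential quantifier is witnessed after passing to a cover. -/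
lemma comp_holds {A B D : C} (R : IntRel A B) (S : IntRel B D) {T : C} (a : T ⟶ A) (d : T ⟶ D) :
    (comp R S).Holds a d ↔ ∃ (T' : C) (p : T' ⟶ T) (_ : IsRegularEpi p) (b : T' ⟶ B),
      R.Holds (p ≫ a) b ∧ S.Holds b (p ≫ d) := by
  unfold comp
  rw [ofSpan_holds]
  constructor
  · rintro ⟨T', p, hp, x, h1, h2⟩
    refine ⟨T', p, hp, x ≫ pullback.fst R.snd S.fst ≫ R.snd, ?_, ?_⟩
    · rw [holds_iff_exists]
      exact ⟨x ≫ pullback.fst _ _, by simpa using h1, by simp⟩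
    · rw [holds_iff_exists]
      exact ⟨x ≫ pullback.snd _ _, by simp [pullback.condition], by simpa using h2⟩
  · rintro ⟨T', p, hp, b, h1, h2⟩
    rw [holds_iff_exists] at h1 h2
    obtain ⟨x, hx1, hx2⟩ := h1
    obtain ⟨y, hy1, hy2⟩ := h2
    exact ⟨T', p, hp, pullback.lift x y (by rw [hx2, hy1]), by simp [hx1], by simp [hy2]⟩

lemma comp_holds_of {A B D : C} {R : IntRel A B} {S : IntRel B D} {T : C} {a : T ⟶ A} {d : T ⟶ D}
    (b : T ⟶ B) (h1 : R.Holds a b) (h2 : S.Holds b d) : (comp R S).Holds a d :=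
  (comp_holds R S a d).2 ⟨T, 𝟙 T, inferInstance, b, by simpa using h1, by simpa using h2⟩

lemma ident_comp {A B : C} (R : IntRel A B) : comp (ident A) R = R := by
  apply ext_holds
  intro T a b
  constructor
  · intro h
    obtain ⟨T', p, hp, x, h1, h2⟩ := (comp_holds _ _ _ _).1 h
    rw [ident_holds] at h1
    subst h1
    exact h2.descend p
  · intro h
    exact comp_holds_of a ((ident_holds _ _).2 rfl) h

lemma comp_ident {A B : C} (R : IntRel A B) : comp R (ident B) = R := by
  apply ext_holds
  intro T a b
  constructor
  · intro h
    obtain ⟨T', p, hp, x, h1, h2⟩ := (comp_holds _ _ _ _).1 h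
    rw [ident_holds] at h2
    subst h2
    exact h1.descend p
  · intro h
    exact comp_holds_of b h ((ident_holds _ _).2 rfl)

lemma comp_assoc {A B D E : C} (R : IntRel A B) (S : IntRel B D) (Q : IntRel D E) :
    comp (comp R S) Q = comp R (comp S Q) := by
  apply ext_holds
  intro T a e
  constructor
  · intro h
    obtain ⟨T', p, hp, d, h1, h2⟩ := (comp_holds _ _ _ _).1 h
    obtain ⟨T'', q, hq, b, h3, h4⟩ := (comp_holds _ _ _ _).1 h1
    apply Holds.descend p
    apply Holds.descend q
    exact comp_holds_of b h3 (comp_holds_of _ h4 (h2.pull q))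
  · intro h
    obtain ⟨T', p, hp, b, h1, h2⟩ := (comp_holds _ _ _ _).1 h
    obtain ⟨T'', q, hq, d, h3, h4⟩ := (comp_holds _ _ _ _).1 h2
    apply Holds.descend p
    apply Holds.descend q
    exact comp_holds_of d (comp_holds_of _ (h1.pull q) h3) h4

end IntRel

variable (C) in
/-- A regular category is positively regular if every reflexive symmetric relation in it is
positive. -/
def IsPositivelyRegular : Prop :=
  ∀ ⦃A : C⦄ (R : IntRel A A), R.Reflexive → R.Symmetric → R.IsPositive

end RegularCategory

variable (C : Type u) [Category.{v} C] in
/-- The objects of the category `Rel(C)` of relations: the objects of `C`. -/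
structure RelationCat where
  /-- The underlying object of `C`. -/
  of : C

instance (C : Type u) [Category.{v} C] [Regular C] : Category.{max u v} (RelationCat C) where
  Hom A B := IntRel A.of B.of
  id A := IntRel.ident A.of
  comp R S := IntRel.comp R S
  id_comp R := IntRel.ident_comp R
  comp_id R := IntRel.comp_ident R
  assoc R S Q := IntRel.comp_assoc R S Q

/-! ### Special dagger Frobenius structures and completely positive relations -/

/-- A special dagger Frobenius structure in `Rel(C)`, with multiplication `mult`, comultiplication
`mult†`, and unit `unit`. The tensor product on `Rel(C)` is `IntRel.tensor`, with tensor unit the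
terminal object of `C`, and its structure isomorphisms are the graphs of those of `C`. -/
structure FrobeniusStructure (C : Type u) [Category.{v} C] [Regular C] where
  /-- The underlying object. -/
  carrier : C
  /-- The multiplication. -/
  mult : IntRel (carrier ⨯ carrier) carrier
  /-- The unit. -/
  unit : IntRel (⊤_ C) carrier
  unit_mult : IntRel.comp (IntRel.tensor unit (IntRel.ident carrier)) mult = IntRel.graph prod.snd
  mult_unit : IntRel.comp (IntRel.tensor (IntRel.ident carrier) unit) mult = IntRel.graph prod.fst
  assoc : IntRel.comp (IntRel.tensor mult (IntRel.ident carrier)) mult =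
    IntRel.comp (IntRel.graph (prod.associator carrier carrier carrier).hom)
      (IntRel.comp (IntRel.tensor (IntRel.ident carrier) mult) mult)
  special : IntRel.comp (IntRel.dagger mult) mult = IntRel.ident carrier
  frobenius :
    IntRel.comp (IntRel.tensor (IntRel.ident carrier) (IntRel.dagger mult))
      (IntRel.comp (IntRel.graph (prod.associator carrier carrier carrier).inv)
        (IntRel.tensor mult (IntRel.ident carrier))) =
    IntRel.comp (IntRel.tensor (IntRel.dagger mult) (IntRel.ident carrier))
      (IntRel.comp (IntRel.graph (prod.associator carrier carrier carrier).hom)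
        (IntRel.tensor (IntRel.ident carrier) mult))

/-- The Choi matrix `(1 ⊗ μ_B) ∘ (1 ⊗ R ⊗ 1) ∘ (δ_A ⊗ 1) : A ⊗ B ⟶ A ⊗ B` of a relation `R` from
`A` to `B`, where `A` and `B` carry the multiplications `μ_A`, `μ_B` and `δ_A = μ_A†`. -/
def choi {C : Type u} [Category.{v} C] [Regular C] {A B : C} (μA : IntRel (A ⨯ A) A)
    (μB : IntRel (B ⨯ B) B) (R : IntRel A B) : IntRel (A ⨯ B) (A ⨯ B) :=
  IntRel.comp (IntRel.tensor (IntRel.dagger μA) (IntRel.ident B))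
    (IntRel.comp (IntRel.graph (prod.associator A A B).hom)
      (IntRel.comp (IntRel.tensor (IntRel.ident A) (IntRel.tensor R (IntRel.ident B)))
        (IntRel.tensor (IntRel.ident A) μB)))

/-- A relation between Frobenius structures is completely positive if its Choi matrix is
positive. -/
def IsCompletelyPositive {C : Type u} [Category.{v} C] [Regular C] (F G : FrobeniusStructure C)
    (R : IntRel F.carrier G.carrier) : Prop :=
  (choi F.mult G.mult R).IsPositive

section

variable {C : Type u} [Category.{v} C] [Regular C]

open IntRel

lemma lift_eta {T A B : C} (x : T ⟶ A ⨯ B) : prod.lift (x ≫ prod.fst) (x ≫ prod.snd) = x := by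
  ext <;> simp

lemma tensor_ident_comp_holds {A B D E : C} (R : IntRel A B) (S : IntRel (B ⨯ D) E) {T : C}
    (a : T ⟶ A) (d : T ⟶ D) (e : T ⟶ E) :
    (comp (tensor R (ident D)) S).Holds (prod.lift a d) e ↔
      ∃ (T' : C) (p : T' ⟶ T) (_ : IsRegularEpi p) (b : T' ⟶ B),
        R.Holds (p ≫ a) b ∧ S.Holds (prod.lift b (p ≫ d)) (p ≫ e) := by
  rw [comp_holds]
  refine exists_congr fun T' => exists_congr fun p => exists_congr fun _ => ?_
  constructor
  · rintro ⟨x, h1, h2⟩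
    rw [tensor_holds, ident_holds] at h1
    simp at h1
    refine ⟨x ≫ prod.fst, h1.1, ?_⟩
    rw [h1.2, lift_eta]
    exact h2
  · rintro ⟨b, h1, h2⟩
    refine ⟨prod.lift b (p ≫ d), ?_, h2⟩
    rw [tensor_holds, ident_holds]
    simpa using h1

lemma ident_tensor_comp_holds {A B D E : C} (R : IntRel A B) (S : IntRel (D ⨯ B) E) {T : C}
    (d : T ⟶ D) (a : T ⟶ A) (e : T ⟶ E) :
    (comp (tensor (ident D) R) S).Holds (prod.lift d a) e ↔
      ∃ (T' : C) (p : T' ⟶ T) (_ : IsRegularEpi p) (b : T' ⟶ B),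
        R.Holds (p ≫ a) b ∧ S.Holds (prod.lift (p ≫ d) b) (p ≫ e) := by
  rw [comp_holds]
  refine exists_congr fun T' => exists_congr fun p => exists_congr fun _ => ?_
  constructor
  · rintro ⟨x, h1, h2⟩
    rw [tensor_holds, ident_holds] at h1
    simp at h1
    refine ⟨x ≫ prod.snd, h1.2, ?_⟩
    rw [h1.1, lift_eta]
    exact h2
  · rintro ⟨b, h1, h2⟩
    refine ⟨prod.lift (p ≫ d) b, ?_, h2⟩
    rw [tensor_holds, ident_holds]
    simpa using h1

lemma graph_comp_holds {A B D : C} (f : A ⟶ B) (S : IntRel B D) {T : C} (a : T ⟶ A) (d : T ⟶ D) :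
    (comp (graph f) S).Holds a d ↔ S.Holds (a ≫ f) d := by
  constructor
  · intro h
    obtain ⟨T', p, hp, x, h1, h2⟩ := (comp_holds _ _ _ _).1 h
    rw [graph_holds] at h1
    subst h1
    rw [Category.assoc] at h2
    exact h2.descend p
  · intro h
    exact comp_holds_of _ ((graph_holds _ _ _).2 rfl) h

lemma associator_hom_holds {A B D E : C} (S : IntRel (A ⨯ (B ⨯ D)) E) {T : C} (a : T ⟶ A) (b : T ⟶ B)
    (d : T ⟶ D) (e : T ⟶ E) :
    (comp (graph (prod.associator A B D).hom) S).Holds (prod.lift (prod.lift a b) d) e ↔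
      S.Holds (prod.lift a (prod.lift b d)) e := by
  rw [graph_comp_holds]
  have : prod.lift (prod.lift a b) d ≫ (prod.associator A B D).hom =
      prod.lift a (prod.lift b d) := by
    ext <;> simp
  rw [this]

lemma associator_inv_holds {A B D E : C} (S : IntRel ((A ⨯ B) ⨯ D) E) {T : C} (a : T ⟶ A) (b : T ⟶ B)
    (d : T ⟶ D) (e : T ⟶ E) :
    (comp (graph (prod.associator A B D).inv) S).Holds (prod.lift a (prod.lift b d)) e ↔
      S.Holds (prod.lift (prod.lift a b) d) e := by
  rw [graph_comp_holds]
  have : prod.lift a (prod.lift b d) ≫ (prod.associator A B D).inv =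
      prod.lift (prod.lift a b) d := by
    ext <;> simp
  rw [this]

/-- The Choi matrix relates `(a, b)` to `(a', b')` iff there are `x`, `y` with `a = a' x`,
`R(x, y)` and `b' = y b`. -/
lemma choi_holds {A B : C} (μA : IntRel (A ⨯ A) A) (μB : IntRel (B ⨯ B) B) (R : IntRel A B) {T : C}
    (a a' : T ⟶ A) (b b' : T ⟶ B) :
    (choi μA μB R).Holds (prod.lift a b) (prod.lift a' b') ↔
      ∃ (T' : C) (p : T' ⟶ T) (_ : IsRegularEpi p) (x : T' ⟶ A) (y : T' ⟶ B),
        μA.Holds (prod.lift (p ≫ a') x) (p ≫ a) ∧ R.Holds x y ∧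
          μB.Holds (prod.lift y (p ≫ b)) (p ≫ b') := by
  unfold choi
  rw [tensor_ident_comp_holds]
  constructor
  · rintro ⟨T', p, hp, z, h1, h2⟩
    rw [dagger_holds] at h1
    rw [← lift_eta z, associator_hom_holds, ident_tensor_comp_holds] at h2
    obtain ⟨T'', q, hq, w, h3, h4⟩ := h2
    rw [tensor_holds, ident_holds] at h3
    rw [tensor_holds, ident_holds] at h4
    simp at h3 h4
    have h1' := h1.pull q
    refine ⟨T'', q ≫ p, inferInstance, q ≫ z ≫ prod.snd, w ≫ prod.fst, ?_, h3.1, ?_⟩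
    · have e : prod.lift ((q ≫ p) ≫ a') (q ≫ z ≫ prod.snd) = q ≫ z := by
        ext
        · simpa using h4.1.symm
        · simp
      rw [e, Category.assoc]
      exact h1'
    · have e : prod.lift (w ≫ prod.fst) ((q ≫ p) ≫ b) = w := by
        ext
        · simp
        · simpa using h3.2
      rw [e]
      simpa using h4.2
  · rintro ⟨T', p, hp, x, y, h1, h2, h3⟩
    refine ⟨T', p, hp, prod.lift (p ≫ a') x, (dagger_holds _ _ _).2 h1, ?_⟩
    rw [associator_hom_holds, ident_tensor_comp_holds]
    refine ⟨T', 𝟙 _, inferInstance, prod.lift y (p ≫ b), ?_, ?_⟩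
    · rw [tensor_holds, ident_holds]
      simpa using h2
    · rw [tensor_holds, ident_holds]
      simpa using h3

namespace FrobeniusStructure

variable (F : FrobeniusStructure C)

/-- `F.M a b c` says that the multiplication relates `(a, b)` to `c`. -/
def M {T : C} (a b c : T ⟶ F.carrier) : Prop := F.mult.Holds (prod.lift a b) c

/-- `F.U x` says that `x` lies in the unit. -/
def U {T : C} (x : T ⟶ F.carrier) : Prop := F.unit.Holds (terminal.from T) x

variable {F} {T : C}

lemma M.pull {a b c : T ⟶ F.carrier} (h : F.M a b c) {T' : C} (p : T' ⟶ T) :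
    F.M (p ≫ a) (p ≫ b) (p ≫ c) := by
  simpa [M] using Holds.pull h p

lemma M.descend {a b c : T ⟶ F.carrier} {T' : C} (p : T' ⟶ T) [IsRegularEpi p]
    (h : F.M (p ≫ a) (p ≫ b) (p ≫ c)) : F.M a b c := by
  unfold M at *
  rw [← prod.comp_lift] at h
  exact Holds.descend p h

lemma U.pull {x : T ⟶ F.carrier} (h : F.U x) {T' : C} (p : T' ⟶ T) : F.U (p ≫ x) := by
  have := Holds.pull h p
  rwa [Subsingleton.elim (p ≫ terminal.from T) (terminal.from T')] at this

lemma eq_of_unit_left {x a b : T ⟶ F.carrier} (hx : F.U x) (h : F.M x a b) : a = b := by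
  have : (comp (tensor F.unit (ident F.carrier)) F.mult).Holds
      (prod.lift (terminal.from T) a) b :=
    (tensor_ident_comp_holds _ _ _ _ _).2 ⟨T, 𝟙 _, inferInstance, x, by simpa [U] using hx,
      by simpa [M] using h⟩
  rw [F.unit_mult, graph_holds] at this
  simpa using this

lemma eq_of_unit_right {x a b : T ⟶ F.carrier} (hx : F.U x) (h : F.M a x b) : a = b := by
  have : (comp (tensor (ident F.carrier) F.unit) F.mult).Holds
      (prod.lift a (terminal.from T)) b :=
    (ident_tensor_comp_holds _ _ _ _ _).2 ⟨T, 𝟙 _, inferInstance, x, by simpa [U] using hx,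
      by simpa [M] using h⟩
  rw [F.mult_unit, graph_holds] at this
  simpa using this

lemma exists_unit_left (a : T ⟶ F.carrier) :
    ∃ (T' : C) (p : T' ⟶ T) (_ : IsRegularEpi p) (x : T' ⟶ F.carrier),
      F.U x ∧ F.M x (p ≫ a) (p ≫ a) := by
  have : (comp (tensor F.unit (ident F.carrier)) F.mult).Holds
      (prod.lift (terminal.from T) a) a := by
    rw [F.unit_mult, graph_holds]
    simp
  obtain ⟨T', p, hp, x, h1, h2⟩ := (tensor_ident_comp_holds _ _ _ _ _).1 this
  rw [Subsingleton.elim (p ≫ terminal.from T) (terminal.from T')] at h1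
  exact ⟨T', p, hp, x, h1, h2⟩

lemma exists_unit_right (a : T ⟶ F.carrier) :
    ∃ (T' : C) (p : T' ⟶ T) (_ : IsRegularEpi p) (x : T' ⟶ F.carrier),
      F.U x ∧ F.M (p ≫ a) x (p ≫ a) := by
  have : (comp (tensor (ident F.carrier) F.unit) F.mult).Holds
      (prod.lift a (terminal.from T)) a := by
    rw [F.mult_unit, graph_holds]
    simp
  obtain ⟨T', p, hp, x, h1, h2⟩ := (ident_tensor_comp_holds _ _ _ _ _).1 this
  rw [Subsingleton.elim (p ≫ terminal.from T) (terminal.from T')] at h1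
  exact ⟨T', p, hp, x, h1, h2⟩

lemma assoc_iff (a b c d : T ⟶ F.carrier) :
    (∃ (T' : C) (p : T' ⟶ T) (_ : IsRegularEpi p) (e : T' ⟶ F.carrier),
      F.M (p ≫ a) (p ≫ b) e ∧ F.M e (p ≫ c) (p ≫ d)) ↔
    (∃ (T' : C) (p : T' ⟶ T) (_ : IsRegularEpi p) (e : T' ⟶ F.carrier),
      F.M (p ≫ b) (p ≫ c) e ∧ F.M (p ≫ a) e (p ≫ d)) := by
  have h1 := tensor_ident_comp_holds F.mult F.mult (prod.lift a b) c d
  rw [F.assoc, associator_hom_holds, ident_tensor_comp_holds] at h1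
  simp only [prod.comp_lift] at h1
  exact h1.symm

lemma assoc_mp {a b c d e : T ⟶ F.carrier} (h1 : F.M a b e) (h2 : F.M e c d) :
    ∃ (T' : C) (p : T' ⟶ T) (_ : IsRegularEpi p) (f : T' ⟶ F.carrier),
      F.M (p ≫ b) (p ≫ c) f ∧ F.M (p ≫ a) f (p ≫ d) :=
  (assoc_iff a b c d).1 ⟨T, 𝟙 _, inferInstance, e, by simpa using h1, by simpa using h2⟩

lemma assoc_mpr {a b c d e : T ⟶ F.carrier} (h1 : F.M b c e) (h2 : F.M a e d) :
    ∃ (T' : C) (p : T' ⟶ T) (_ : IsRegularEpi p) (f : T' ⟶ F.carrier),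
      F.M (p ≫ a) (p ≫ b) f ∧ F.M f (p ≫ c) (p ≫ d) :=
  (assoc_iff a b c d).2 ⟨T, 𝟙 _, inferInstance, e, by simpa using h1, by simpa using h2⟩

/-- The Frobenius law for a multiplication relation `μ` in the internal logic. -/
lemma frobenius_left_holds {A : C} (μ : IntRel (A ⨯ A) A) (a b c d : T ⟶ A) :
    (comp (tensor (ident A) (dagger μ)) (comp (graph (prod.associator A A A).inv)
        (tensor μ (ident A)))).Holds (prod.lift a b) (prod.lift c d) ↔
    ∃ (T' : C) (p : T' ⟶ T) (_ : IsRegularEpi p) (e : T' ⟶ A),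
      μ.Holds (prod.lift (p ≫ a) e) (p ≫ c) ∧ μ.Holds (prod.lift e (p ≫ d)) (p ≫ b) := by
  rw [ident_tensor_comp_holds]
  refine exists_congr fun T' => exists_congr fun p => exists_congr fun _ => ?_
  constructor
  · rintro ⟨x, h1, h2⟩
    rw [dagger_holds] at h1
    rw [← lift_eta x, associator_inv_holds, tensor_holds, ident_holds] at h2
    simp at h2
    refine ⟨x ≫ prod.fst, h2.1, ?_⟩
    rw [← h2.2, lift_eta]
    exact h1
  · rintro ⟨e, h1, h2⟩
    refine ⟨prod.lift e (p ≫ d), (dagger_holds _ _ _).2 h2, ?_⟩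
    rw [associator_inv_holds, tensor_holds, ident_holds]
    simpa using h1

lemma frobenius_right_holds {A : C} (μ : IntRel (A ⨯ A) A) (a b c d : T ⟶ A) :
    (comp (tensor (dagger μ) (ident A)) (comp (graph (prod.associator A A A).hom)
        (tensor (ident A) μ))).Holds (prod.lift a b) (prod.lift c d) ↔
    ∃ (T' : C) (p : T' ⟶ T) (_ : IsRegularEpi p) (e : T' ⟶ A),
      μ.Holds (prod.lift (p ≫ c) e) (p ≫ a) ∧ μ.Holds (prod.lift e (p ≫ b)) (p ≫ d) := by
  rw [tensor_ident_comp_holds]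
  refine exists_congr fun T' => exists_congr fun p => exists_congr fun _ => ?_
  constructor
  · rintro ⟨x, h1, h2⟩
    rw [dagger_holds] at h1
    rw [← lift_eta x, associator_hom_holds, tensor_holds, ident_holds] at h2
    simp at h2
    refine ⟨x ≫ prod.snd, ?_, h2.2⟩
    rw [← h2.1, lift_eta]
    exact h1
  · rintro ⟨e, h1, h2⟩
    refine ⟨prod.lift (p ≫ c) e, (dagger_holds _ _ _).2 h1, ?_⟩
    rw [associator_hom_holds, tensor_holds, ident_holds]
    simpa using h2

lemma frobenius_iff (a b c d : T ⟶ F.carrier) :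
    (∃ (T' : C) (p : T' ⟶ T) (_ : IsRegularEpi p) (e : T' ⟶ F.carrier),
      F.M (p ≫ a) e (p ≫ c) ∧ F.M e (p ≫ d) (p ≫ b)) ↔
    (∃ (T' : C) (p : T' ⟶ T) (_ : IsRegularEpi p) (e : T' ⟶ F.carrier),
      F.M (p ≫ c) e (p ≫ a) ∧ F.M e (p ≫ b) (p ≫ d)) := by
  have h1 := frobenius_left_holds F.mult a b c d
  rw [F.frobenius, frobenius_right_holds] at h1
  exact h1.symm

lemma frobenius_mp {a b c d e : T ⟶ F.carrier} (h1 : F.M a e c) (h2 : F.M e d b) :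
    ∃ (T' : C) (p : T' ⟶ T) (_ : IsRegularEpi p) (e : T' ⟶ F.carrier),
      F.M (p ≫ c) e (p ≫ a) ∧ F.M e (p ≫ b) (p ≫ d) :=
  (frobenius_iff a b c d).1 ⟨T, 𝟙 _, inferInstance, e, by simpa using h1, by simpa using h2⟩

/-- If `a e = c` and `e d = u` with `u` a unit, then `c d = a`. -/
lemma shift_right {a c d e u : T ⟶ F.carrier} (hu : F.U u) (h1 : F.M a e c) (h2 : F.M e d u) :
    F.M c d a := by
  obtain ⟨T', p, hp, f, h3, h4⟩ := frobenius_mp h1 h2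
  have : f = p ≫ d := eq_of_unit_right (hu.pull p) h4
  subst this
  exact h3.descend p

/-- If `c d = a` and `d u = d` then, locally, there is `e` with `a e = c` and `e d = u`. -/
lemma shift_left {a c d u : T ⟶ F.carrier} (h1 : F.M c d a) (h2 : F.M d u d) :
    ∃ (T' : C) (p : T' ⟶ T) (_ : IsRegularEpi p) (e : T' ⟶ F.carrier),
      F.M (p ≫ a) e (p ≫ c) ∧ F.M e (p ≫ d) (p ≫ u) :=
  frobenius_mp h1 h2

/-- The composites in the Frobenius law are also equal to `δ ∘ μ`. -/
lemma mult_mult_iff (a b c d : T ⟶ F.carrier) :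
    (∃ (T' : C) (p : T' ⟶ T) (_ : IsRegularEpi p) (e : T' ⟶ F.carrier),
      F.M (p ≫ c) e (p ≫ a) ∧ F.M e (p ≫ b) (p ≫ d)) ↔
    (∃ (T' : C) (p : T' ⟶ T) (_ : IsRegularEpi p) (e : T' ⟶ F.carrier),
      F.M (p ≫ a) (p ≫ b) e ∧ F.M (p ≫ c) (p ≫ d) e) := by
  rw [← frobenius_iff]
  constructor
  · rintro ⟨T1, p, hp, e, h1, h2⟩
    obtain ⟨T2, q, hq, u, hu, h3⟩ := exists_unit_right (p ≫ d)
    obtain ⟨T3, r, hr, f, h4, h5⟩ := shift_left (h2.pull q) h3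
    obtain ⟨T4, s, hs, g, h6, h7⟩ := assoc_mpr h4 ((h1.pull q).pull r)
    have h8 := shift_right ((hu.pull r).pull s) h7 (h5.pull s)
    exact ⟨T4, s ≫ r ≫ q ≫ p, inferInstance, g, by simpa using h6, by simpa using h8⟩
  · rintro ⟨T1, p, hp, g, h1, h2⟩
    obtain ⟨T2, q, hq, u, hu, h3⟩ := exists_unit_right (p ≫ d)
    obtain ⟨T3, r, hr, f, h4, h5⟩ := shift_left (h2.pull q) h3
    obtain ⟨T4, s, hs, e, h6, h7⟩ := assoc_mp ((h1.pull q).pull r) h4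
    have h8 := shift_right ((hu.pull r).pull s) h6 (h5.pull s)
    exact ⟨T4, s ≫ r ≫ q ≫ p, inferInstance, e, by simpa using h7, by simpa using h8⟩

end FrobeniusStructure

lemma isCompletelyPositive_ident (F : FrobeniusStructure C) :
    IsCompletelyPositive F F (ident F.carrier) := by
  refine ⟨F.carrier, F.mult, ?_⟩
  apply ext_holds
  intro T x y
  rw [← lift_eta x, ← lift_eta y, choi_holds, comp_holds]
  generalize x ≫ prod.fst = a
  generalize x ≫ prod.snd = b
  generalize y ≫ prod.fst = c
  generalize y ≫ prod.snd = d
  have key := FrobeniusStructure.mult_mult_iff (F := F) a b c d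
  simp only [dagger_holds, prod.comp_lift]
  refine Iff.trans ?_ key
  refine exists_congr fun T' => exists_congr fun p => exists_congr fun _ => ?_
  constructor
  · rintro ⟨e, e', h1, h2, h3⟩
    rw [ident_holds] at h2
    subst h2
    exact ⟨e, h1, h3⟩
  · rintro ⟨e, h1, h3⟩
    exact ⟨e, e, h1, (ident_holds _ _).2 rfl, h3⟩

/-- If `y b₁ = b₁'`, `b₂' w = b₂` with `b₁ b₂` and `b₁' b₂'` units, then `y = w`. -/
lemma FrobeniusStructure.eq_of_units {F : FrobeniusStructure C} {T : C}
    {y w b₁ b₁' b₂ b₂' u u' : T ⟶ F.carrier} (hu : F.U u) (hu' : F.U u')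
    (h1 : F.M y b₁ b₁') (h2 : F.M b₂' w b₂) (h3 : F.M b₁ b₂ u) (h4 : F.M b₁' b₂' u') :
    ∃ (T' : C) (p : T' ⟶ T) (_ : IsRegularEpi p), p ≫ y = p ≫ w := by
  obtain ⟨T1, p, hp, e, h5, h6⟩ := assoc_mp h1 h4
  obtain ⟨T2, q, hq, e', h7, h8⟩ := assoc_mpr (h2.pull p) (h3.pull p)
  -- `e = b₁ b₂' = e'`
  have e1 : e' = q ≫ e := by
    have hs : (comp (dagger F.mult) F.mult).Holds e' (q ≫ e) :=
      comp_holds_of (prod.lift (q ≫ p ≫ b₁) (q ≫ p ≫ b₂'))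
        ((dagger_holds _ _ _).2 h7) (h5.pull q)
    rwa [F.special, ident_holds] at hs
  subst e1
  obtain ⟨T3, r, hr, f, h9, h10⟩ := frobenius_mp (h6.pull q) h8
  have e2 := eq_of_unit_left (((hu'.pull p).pull q).pull r) h9
  have e3 := eq_of_unit_right (((hu.pull p).pull q).pull r) h10
  exact ⟨T3, r ≫ q ≫ p, inferInstance, by simp [← e2, ← e3]⟩

lemma FrobeniusStructure.unit_idem {F : FrobeniusStructure C} {T : C} {u : T ⟶ F.carrier}
    (hu : F.U u) : F.M u u u := by
  obtain ⟨T', p, hp, x, hx, h⟩ := exists_unit_left u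
  have e := eq_of_unit_right (hu.pull p) h
  subst e
  exact h.descend p

/-- The relation `{((a, d), ((a, b₁), (b₂, d))) | b₁ b₂ is a unit}`. -/
def bend (G : FrobeniusStructure C) (A D : C) :
    IntRel (A ⨯ D) ((A ⨯ G.carrier) ⨯ (G.carrier ⨯ D)) :=
  ((Subobject.pullback (prod.map prod.fst (prod.fst ≫ prod.fst))).obj (ident A) ⊓
    (Subobject.pullback (prod.map prod.snd (prod.snd ≫ prod.snd))).obj (ident D)) ⊓
    (Subobject.pullback (prod.lift
      (prod.lift (prod.snd ≫ prod.fst ≫ prod.snd) (prod.snd ≫ prod.snd ≫ prod.fst))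
      (terminal.from _))).obj (IntRel.comp G.mult (dagger G.unit))

lemma bend_holds (G : FrobeniusStructure C) {A D T : C} (a a' : T ⟶ A) (d d' : T ⟶ D)
    (b₁ b₂ : T ⟶ G.carrier) :
    (bend G A D).Holds (prod.lift a d) (prod.lift (prod.lift a' b₁) (prod.lift b₂ d')) ↔
      (a = a' ∧ d = d') ∧ (IntRel.comp G.mult (dagger G.unit)).Holds (prod.lift b₁ b₂)
        (terminal.from T) := by
  rw [← ident_holds, ← ident_holds]
  unfold bend Holds
  rw [Subobject.inf_factors, Subobject.inf_factors, pullback_factors_iff, pullback_factors_iff,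
    pullback_factors_iff]
  simp

lemma bend_comp_holds (G : FrobeniusStructure C) {A D X Y T : C} (P : IntRel (A ⨯ G.carrier) X)
    (Q : IntRel (G.carrier ⨯ D) Y) (a : T ⟶ A) (d : T ⟶ D) (s : T ⟶ X) (t : T ⟶ Y) :
    (IntRel.comp (bend G A D) (tensor P Q)).Holds (prod.lift a d) (prod.lift s t) ↔
      ∃ (T' : C) (p : T' ⟶ T) (_ : IsRegularEpi p) (b₁ b₂ u : T' ⟶ G.carrier),
        G.U u ∧ G.M b₁ b₂ u ∧ P.Holds (prod.lift (p ≫ a) b₁) (p ≫ s) ∧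
          Q.Holds (prod.lift b₂ (p ≫ d)) (p ≫ t) := by
  rw [comp_holds]
  constructor
  · rintro ⟨T', p, hp, w, h1, h2⟩
    obtain ⟨a', b₁, b₂, d', rfl⟩ : ∃ a' b₁ b₂ d',
        w = prod.lift (prod.lift a' b₁) (prod.lift b₂ d') :=
      ⟨_, _, _, _, by rw [lift_eta, lift_eta, lift_eta]⟩
    rw [prod.comp_lift, bend_holds, comp_holds] at h1
    obtain ⟨⟨rfl, rfl⟩, T'', q, hq, u, h3, h4⟩ := h1
    rw [dagger_holds, Subsingleton.elim (q ≫ terminal.from T') (terminal.from T'')] at h4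
    rw [tensor_holds] at h2
    simp at h2
    have h5 := h2.1.pull q
    have h6 := h2.2.pull q
    simp at h3 h5 h6
    exact ⟨T'', q ≫ p, inferInstance, q ≫ b₁, q ≫ b₂, u, h4, h3, by simpa using h5,
      by simpa using h6⟩
  · rintro ⟨T', p, hp, b₁, b₂, u, h1, h2, h3, h4⟩
    refine ⟨T', p, hp, prod.lift (prod.lift (p ≫ a) b₁) (prod.lift b₂ (p ≫ d)), ?_, ?_⟩
    · rw [prod.comp_lift, bend_holds]
      exact ⟨⟨rfl, rfl⟩, comp_holds_of u h2 ((dagger_holds _ _ _).2 h1)⟩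
    · rw [tensor_holds]
      simpa using ⟨h3, h4⟩

lemma IsCompletelyPositive.comp {F G H : FrobeniusStructure C} {R : IntRel F.carrier G.carrier}
    {S : IntRel G.carrier H.carrier} (hR : IsCompletelyPositive F G R)
    (hS : IsCompletelyPositive G H S) : IsCompletelyPositive F H (IntRel.comp R S) := by
  obtain ⟨X, P, hP⟩ := hR
  obtain ⟨Y, Q, hQ⟩ := hS
  refine ⟨X ⨯ Y, IntRel.comp (bend G F.carrier H.carrier) (tensor P Q), ?_⟩
  apply ext_holds
  intro T x y
  rw [← lift_eta x, ← lift_eta y]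
  generalize x ≫ prod.fst = a
  generalize x ≫ prod.snd = d
  generalize y ≫ prod.fst = a'
  generalize y ≫ prod.snd = d'
  constructor
  · intro h
    obtain ⟨T1, p1, hp1, x, z, h1, h2, h3⟩ := (choi_holds _ _ _ _ _ _ _).1 h
    obtain ⟨T2, p2, hp2, y, h4, h5⟩ := (comp_holds _ _ _ _).1 h2
    obtain ⟨T3, p3, hp3, u', hu', h6⟩ := FrobeniusStructure.exists_unit_left y
    obtain ⟨T4, p4, hp4, u, hu, h7⟩ := FrobeniusStructure.exists_unit_right (p3 ≫ y)
    obtain ⟨T5, p5, hp5, e, h8, h9⟩ := FrobeniusStructure.shift_left (h6.pull p4) h7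
    -- everything now lives over `T5`
    let q := p5 ≫ p4 ≫ p3 ≫ p2 ≫ p1
    have hq : IsRegularEpi q := inferInstance
    have h1' := h1.pull (p5 ≫ p4 ≫ p3 ≫ p2)
    have h3' := h3.pull (p5 ≫ p4 ≫ p3 ≫ p2)
    have h4' := h4.pull (p5 ≫ p4 ≫ p3)
    have h5' := h5.pull (p5 ≫ p4 ≫ p3)
    have h7' := h7.pull p5
    have c1 : (choi F.mult G.mult R).Holds (prod.lift (q ≫ a) (p5 ≫ u))
        (prod.lift (q ≫ a') (p5 ≫ p4 ≫ p3 ≫ y)) := by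
      rw [choi_holds]
      exact ⟨_, 𝟙 _, inferInstance, p5 ≫ p4 ≫ p3 ≫ p2 ≫ x, p5 ≫ p4 ≫ p3 ≫ y,
        by simpa [q] using h1', by simpa using h4',
        by simpa [FrobeniusStructure.M] using h7'⟩
    have c2 : (choi G.mult H.mult S).Holds (prod.lift (p5 ≫ u) (q ≫ d))
        (prod.lift e (q ≫ d')) := by
      rw [choi_holds]
      exact ⟨_, 𝟙 _, inferInstance, p5 ≫ p4 ≫ p3 ≫ y, p5 ≫ p4 ≫ p3 ≫ p2 ≫ z,
        by simpa [FrobeniusStructure.M] using h9, by simpa using h5', by simpa [q] using h3'⟩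
    rw [hP] at c1
    rw [hQ] at c2
    obtain ⟨T6, p6, hp6, s, c3, c4⟩ := (comp_holds _ _ _ _).1 c1
    obtain ⟨T7, p7, hp7, t, c5, c6⟩ := (comp_holds _ _ _ _).1 (c2.pull p6)
    rw [dagger_holds] at c4 c6
    have c3' := c3.pull p7
    have c4' := c4.pull p7
    apply Holds.descend (p7 ≫ p6 ≫ q)
    rw [prod.comp_lift, prod.comp_lift]
    refine comp_holds_of (prod.lift (p7 ≫ s) t) ?_ ((dagger_holds _ _ _).2 ?_)
    · rw [bend_comp_holds]
      refine ⟨_, 𝟙 _, inferInstance, p7 ≫ p6 ≫ p5 ≫ u, p7 ≫ p6 ≫ p5 ≫ u, p7 ≫ p6 ≫ p5 ≫ u,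
        ((hu.pull p5).pull p6).pull p7,
        FrobeniusStructure.unit_idem (((hu.pull p5).pull p6).pull p7), ?_, ?_⟩
      · simpa [q] using c3'
      · simpa [q] using c5
    · rw [bend_comp_holds]
      refine ⟨_, 𝟙 _, inferInstance, p7 ≫ p6 ≫ p5 ≫ p4 ≫ p3 ≫ y, p7 ≫ p6 ≫ e,
        p7 ≫ p6 ≫ p5 ≫ p4 ≫ u', (((hu'.pull p4).pull p5).pull p6).pull p7,
        (h8.pull p6).pull p7, ?_, ?_⟩
      · simpa [q] using c4'
      · simpa [q] using c6
  · intro h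
    obtain ⟨T1, p1, hp1, w, h1, h2⟩ := (comp_holds _ _ _ _).1 h
    rw [dagger_holds] at h2
    obtain ⟨s, t, rfl⟩ : ∃ s t, w = prod.lift s t := ⟨_, _, (lift_eta w).symm⟩
    rw [prod.comp_lift, bend_comp_holds] at h1
    obtain ⟨T2, p2, hp2, b₁, b₂, u, hu, h3, h4, h5⟩ := h1
    have h2' := h2.pull p2
    rw [prod.comp_lift, prod.comp_lift, prod.comp_lift, bend_comp_holds] at h2'
    obtain ⟨T3, p3, hp3, b₁', b₂', u', hu', h6, h7, h8⟩ := h2'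
    have h4' := h4.pull p3
    have h5' := h5.pull p3
    simp only [prod.comp_lift] at h4' h5'
    have c1 := comp_holds_of _ h4' ((dagger_holds _ _ _).2 h7)
    have c2 := comp_holds_of _ h5' ((dagger_holds _ _ _).2 h8)
    rw [← hP, choi_holds] at c1
    obtain ⟨T4, p4, hp4, x, y, d1, d2, d3⟩ := c1
    have c2' := c2.pull p4
    rw [← hQ, prod.comp_lift, prod.comp_lift, choi_holds] at c2'
    obtain ⟨T5, p5, hp5, v, z, d4, d5, d6⟩ := c2'
    obtain ⟨T6, p6, hp6, hyv⟩ := FrobeniusStructure.eq_of_units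
      (((hu.pull p3).pull p4).pull p5) ((hu'.pull p4).pull p5)
      (FrobeniusStructure.M.pull d3 p5) d4 (((h3.pull p3).pull p4).pull p5)
      ((h6.pull p4).pull p5)
    have hq : IsRegularEpi (p6 ≫ p5 ≫ p4 ≫ p3 ≫ p2 ≫ p1) := inferInstance
    apply Holds.descend (p6 ≫ p5 ≫ p4 ≫ p3 ≫ p2 ≫ p1)
    rw [prod.comp_lift, prod.comp_lift, choi_holds]
    refine ⟨T6, 𝟙 _, inferInstance, p6 ≫ p5 ≫ x, p6 ≫ z, ?_, ?_, ?_⟩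
    · simpa using (d1.pull p5).pull p6
    · refine comp_holds_of (p6 ≫ v) ?_ (d5.pull p6)
      rw [← hyv]
      exact (d2.pull p5).pull p6
    · simpa using d6.pull p6

end

/-- A morphism of the category `CP(Rel(C))`: a completely positive relation. -/
@[ext]
structure CPHom {C : Type u} [Category.{v} C] [Regular C] (F G : FrobeniusStructure C) where
  /-- The underlying relation. -/
  rel : IntRel F.carrier G.carrier
  isCompletelyPositive : IsCompletelyPositive F G rel

/-- The category `CP(Rel(C))` of special dagger Frobenius structures in `Rel(C)` and completely
positive relations. -/
instance (C : Type u) [Category.{v} C] [Regular C] :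
    Category.{max u v} (FrobeniusStructure C) where
  Hom F G := CPHom F G
  id F := ⟨IntRel.ident F.carrier, isCompletelyPositive_ident F⟩
  comp R S := ⟨IntRel.comp R.rel S.rel, R.isCompletelyPositive.comp S.isCompletelyPositive⟩
  id_comp R := CPHom.ext (IntRel.ident_comp R.rel)
  comp_id R := CPHom.ext (IntRel.comp_ident R.rel)
  assoc R S Q := CPHom.ext (IntRel.comp_assoc R.rel S.rel Q.rel)

/-! ### Internal categories and groupoids -/

/-- An internal category in a category with finite limits. The composition `m` is defined on the
pullback of `src` and `tgt`: it sends generalized elements `a`, `b` with `src a = tgt b` to the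
composite `a ∘ b`. -/
structure InternalCategory (C : Type u) [Category.{v} C] [HasFiniteLimits C] where
  /-- The object of objects. -/
  obj : C
  /-- The object of morphisms. -/
  arr : C
  /-- The source. -/
  src : arr ⟶ obj
  /-- The target. -/
  tgt : arr ⟶ obj
  /-- The identities. -/
  idn : obj ⟶ arr
  /-- The composition. -/
  m : pullback src tgt ⟶ arr
  idn_src : idn ≫ src = 𝟙 obj
  idn_tgt : idn ≫ tgt = 𝟙 obj
  m_src : m ≫ src = pullback.snd src tgt ≫ src
  m_tgt : m ≫ tgt = pullback.fst src tgt ≫ tgt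
  idn_m : pullback.lift (tgt ≫ idn) (𝟙 arr) (by simp [idn_src]) ≫ m = 𝟙 arr
  m_idn : pullback.lift (𝟙 arr) (src ≫ idn) (by simp [idn_tgt]) ≫ m = 𝟙 arr
  assoc : ∀ ⦃T : C⦄ (a b c : T ⟶ arr) (hab : a ≫ src = b ≫ tgt) (hbc : b ≫ src = c ≫ tgt),
    pullback.lift (pullback.lift a b hab ≫ m) c (by simp [m_src, hbc]) ≫ m =
      pullback.lift a (pullback.lift b c hbc ≫ m) (by simp [m_tgt, hab]) ≫ m

/-- An internal functor between internal categories. -/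
@[ext]
structure InternalFunctor {C : Type u} [Category.{v} C] [HasFiniteLimits C]
    (D E : InternalCategory C) where
  /-- The morphism on objects of objects. -/
  onObj : D.obj ⟶ E.obj
  /-- The morphism on objects of morphisms. -/
  onArr : D.arr ⟶ E.arr
  onArr_src : onArr ≫ E.src = D.src ≫ onObj
  onArr_tgt : onArr ≫ E.tgt = D.tgt ≫ onObj
  idn_onArr : D.idn ≫ onArr = onObj ≫ E.idn
  m_onArr : D.m ≫ onArr =
    pullback.lift (pullback.fst D.src D.tgt ≫ onArr) (pullback.snd D.src D.tgt ≫ onArr)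
      (by simp [onArr_src, onArr_tgt, pullback.condition_assoc]) ≫ E.m

/-- The identity internal functor. -/
def InternalFunctor.ident {C : Type u} [Category.{v} C] [HasFiniteLimits C]
    (D : InternalCategory C) : InternalFunctor D D where
  onObj := 𝟙 _
  onArr := 𝟙 _
  onArr_src := by simp
  onArr_tgt := by simp
  idn_onArr := by simp
  m_onArr := by
    have : pullback.lift (pullback.fst D.src D.tgt ≫ 𝟙 D.arr) (pullback.snd D.src D.tgt ≫ 𝟙 D.arr)
        (by simp [pullback.condition]) = 𝟙 _ := by
      ext <;> simp
    rw [this]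
    simp

/-- The composite of internal functors. -/
def InternalFunctor.comp {C : Type u} [Category.{v} C] [HasFiniteLimits C]
    {D E F : InternalCategory C} (f : InternalFunctor D E) (g : InternalFunctor E F) :
    InternalFunctor D F where
  onObj := f.onObj ≫ g.onObj
  onArr := f.onArr ≫ g.onArr
  onArr_src := by rw [Category.assoc, g.onArr_src, ← Category.assoc, f.onArr_src, Category.assoc]
  onArr_tgt := by rw [Category.assoc, g.onArr_tgt, ← Category.assoc, f.onArr_tgt, Category.assoc]
  idn_onArr := by rw [← Category.assoc, f.idn_onArr, Category.assoc, g.idn_onArr, Category.assoc]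
  m_onArr := by
    rw [← Category.assoc, f.m_onArr, Category.assoc, g.m_onArr, ← Category.assoc]
    congr 1
    ext <;> simp

/-- The category `Cat(C)` of internal categories in `C`. -/
instance (C : Type u) [Category.{v} C] [HasFiniteLimits C] :
    Category.{v} (InternalCategory C) where
  Hom D E := InternalFunctor D E
  id D := InternalFunctor.ident D
  comp f g := InternalFunctor.comp f g
  id_comp f := InternalFunctor.ext (Category.id_comp f.onObj) (Category.id_comp f.onArr)
  comp_id f := InternalFunctor.ext (Category.comp_id f.onObj) (Category.comp_id f.onArr)
  assoc f g h := InternalFunctor.ext (Category.assoc f.onObj g.onObj h.onObj)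
    (Category.assoc f.onArr g.onArr h.onArr)

/-- An internal groupoid: an internal category with an inversion. -/
structure InternalGroupoid (C : Type u) [Category.{v} C] [HasFiniteLimits C] extends
    InternalCategory C where
  /-- The inversion. -/
  inv : arr ⟶ arr
  inv_src : inv ≫ src = tgt
  inv_tgt : inv ≫ tgt = src
  inv_m : pullback.lift inv (𝟙 arr) (by simp [inv_src]) ≫ m = src ≫ idn
  m_inv : pullback.lift (𝟙 arr) inv (by simp [inv_tgt]) ≫ m = tgt ≫ idn

/-- The category `Gpd(C)` of internal groupoids in `C` and internal functors between them. -/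
instance (C : Type u) [Category.{v} C] [HasFiniteLimits C] :
    Category.{v} (InternalGroupoid C) where
  Hom G H := InternalFunctor G.toInternalCategory H.toInternalCategory
  id G := InternalFunctor.ident G.toInternalCategory
  comp f g := InternalFunctor.comp f g
  id_comp f := InternalFunctor.ext (Category.id_comp f.onObj) (Category.id_comp f.onArr)
  comp_id f := InternalFunctor.ext (Category.comp_id f.onObj) (Category.comp_id f.onArr)
  assoc f g h := InternalFunctor.ext (Category.assoc f.onObj g.onObj h.onObj)
    (Category.assoc f.onArr g.onArr h.onArr)

/-- The forgetful functor `Gpd(C) ⥤ Cat(C)`. -/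
def groupoidToCategory (C : Type u) [Category.{v} C] [HasFiniteLimits C] :
    InternalGroupoid C ⥤ InternalCategory C where
  obj G := G.toInternalCategory
  map f := f
  map_id _ := rfl
  map_comp _ _ := rfl

/-- The functor `Gpd(C) ⥤ C` sending a groupoid to its object of morphisms. -/
def groupoidArrows (C : Type u) [Category.{v} C] [HasFiniteLimits C] :
    InternalGroupoid C ⥤ C where
  obj G := G.arr
  map f := InternalFunctor.onArr f
  map_id _ := rfl
  map_comp _ _ := rfl

/-! ### The Frobenius structure of a groupoid -/

section

variable {C : Type u} [Category.{v} C] [Regular C]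

open IntRel

namespace InternalGroupoid

variable (G : InternalGroupoid C)

/-- The composition of a groupoid, as a relation. -/
def multRel : IntRel (G.arr ⨯ G.arr) G.arr :=
  ofSpan (prod.lift (pullback.fst G.src G.tgt) (pullback.snd G.src G.tgt)) G.m

/-- The identities of a groupoid, as a relation. -/
def unitRel : IntRel (⊤_ C) G.arr := ofSpan (terminal.from G.obj) G.idn

/-- `G.Mul a b c` says that `a` and `b` are composable, with composite `c`. -/
def Mul {T : C} (a b c : T ⟶ G.arr) : Prop :=
  ∃ h : a ≫ G.src = b ≫ G.tgt, pullback.lift a b h ≫ G.m = c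

variable {G} {T : C}

lemma multRel_holds (a b c : T ⟶ G.arr) :
    G.multRel.Holds (prod.lift a b) c ↔ G.Mul a b c := by
  unfold multRel Mul
  rw [ofSpan_holds_of_jointly_mono]
  · constructor
    · rintro ⟨x, h1, h2⟩
      have h3 : x ≫ pullback.fst _ _ = a := by simpa using congrArg (· ≫ prod.fst) h1
      have h4 : x ≫ pullback.snd _ _ = b := by simpa using congrArg (· ≫ prod.snd) h1
      refine ⟨by rw [← h3, ← h4, Category.assoc, pullback.condition, Category.assoc], ?_⟩
      rw [← h2]
      congr 1
      ext
      · simpa using h3.symm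
      · simpa using h4.symm
    · rintro ⟨h, rfl⟩
      exact ⟨pullback.lift a b h, by simp, rfl⟩
  · intro T x y h _
    have h3 : x ≫ pullback.fst _ _ = y ≫ pullback.fst _ _ := by
      simpa using congrArg (· ≫ prod.fst) h
    have h4 : x ≫ pullback.snd _ _ = y ≫ pullback.snd _ _ := by
      simpa using congrArg (· ≫ prod.snd) h
    ext
    · exact h3
    · exact h4

lemma unitRel_holds (t : T ⟶ ⊤_ C) (x : T ⟶ G.arr) :
    G.unitRel.Holds t x ↔ ∃ o : T ⟶ G.obj, o ≫ G.idn = x := by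
  unfold unitRel
  rw [ofSpan_holds_of_jointly_mono]
  · exact exists_congr fun o => ⟨fun h => h.2, fun h => ⟨Subsingleton.elim _ _, h⟩⟩
  · intro T x y _ h
    have := congrArg (· ≫ G.src) h
    simpa [G.idn_src] using this

lemma Mul.src_eq {a b c : T ⟶ G.arr} (h : G.Mul a b c) : c ≫ G.src = b ≫ G.src := by
  obtain ⟨h, rfl⟩ := h
  simp [G.m_src]

lemma Mul.tgt_eq {a b c : T ⟶ G.arr} (h : G.Mul a b c) : c ≫ G.tgt = a ≫ G.tgt := by
  obtain ⟨h, rfl⟩ := h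
  simp [G.m_tgt]

lemma Mul.unique {a b c c' : T ⟶ G.arr} (h : G.Mul a b c) (h' : G.Mul a b c') : c = c' := by
  obtain ⟨h, rfl⟩ := h
  obtain ⟨h', rfl⟩ := h'
  rfl

lemma exists_mul {a b : T ⟶ G.arr} (h : a ≫ G.src = b ≫ G.tgt) : ∃ c, G.Mul a b c :=
  ⟨_, h, rfl⟩

lemma Mul.assoc {a b c d e f : T ⟶ G.arr} (h1 : G.Mul a b e) (h2 : G.Mul e c d)
    (h3 : G.Mul b c f) : G.Mul a f d := by
  obtain ⟨h1, rfl⟩ := h1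
  obtain ⟨h2, rfl⟩ := h2
  obtain ⟨h3, rfl⟩ := h3
  exact ⟨_, (G.assoc a b c h1 h3).symm⟩

lemma Mul.assoc' {a b c d e f : T ⟶ G.arr} (h1 : G.Mul a b e) (h2 : G.Mul b c f)
    (h3 : G.Mul a f d) : G.Mul e c d := by
  obtain ⟨h1, rfl⟩ := h1
  obtain ⟨h2, rfl⟩ := h2
  obtain ⟨h3, rfl⟩ := h3
  exact ⟨_, G.assoc a b c h1 h2⟩

lemma idn_mul (a : T ⟶ G.arr) : G.Mul (a ≫ G.tgt ≫ G.idn) a a := by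
  refine ⟨by simp [G.idn_src], ?_⟩
  have : pullback.lift (f := G.src) (g := G.tgt) (a ≫ G.tgt ≫ G.idn) a (by simp [G.idn_src]) =
      a ≫ pullback.lift (G.tgt ≫ G.idn) (𝟙 G.arr) (by simp [G.idn_src]) := by
    ext <;> simp
  rw [this, Category.assoc, G.idn_m, Category.comp_id]

lemma mul_idn (a : T ⟶ G.arr) : G.Mul a (a ≫ G.src ≫ G.idn) a := by
  refine ⟨by simp [G.idn_tgt], ?_⟩
  have : pullback.lift (f := G.src) (g := G.tgt) a (a ≫ G.src ≫ G.idn) (by simp [G.idn_tgt]) =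
      a ≫ pullback.lift (𝟙 G.arr) (G.src ≫ G.idn) (by simp [G.idn_tgt]) := by
    ext <;> simp
  rw [this, Category.assoc, G.m_idn, Category.comp_id]

lemma inv_mul (a : T ⟶ G.arr) : G.Mul (a ≫ G.inv) a (a ≫ G.src ≫ G.idn) := by
  refine ⟨by simp [G.inv_src], ?_⟩
  have : pullback.lift (f := G.src) (g := G.tgt) (a ≫ G.inv) a (by simp [G.inv_src]) =
      a ≫ pullback.lift G.inv (𝟙 G.arr) (by simp [G.inv_src]) := by
    ext <;> simp
  rw [this, Category.assoc, G.inv_m]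

lemma mul_inv (a : T ⟶ G.arr) : G.Mul a (a ≫ G.inv) (a ≫ G.tgt ≫ G.idn) := by
  refine ⟨by simp [G.inv_tgt], ?_⟩
  have : pullback.lift (f := G.src) (g := G.tgt) a (a ≫ G.inv) (by simp [G.inv_tgt]) =
      a ≫ pullback.lift (𝟙 G.arr) G.inv (by simp [G.inv_tgt]) := by
    ext <;> simp
  rw [this, Category.assoc, G.m_inv]

lemma Mul.pull {a b c : T ⟶ G.arr} (h : G.Mul a b c) {T' : C} (p : T' ⟶ T) :
    G.Mul (p ≫ a) (p ≫ b) (p ≫ c) := by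
  rw [← multRel_holds] at *
  simpa using Holds.pull h p

lemma Mul.descend {a b c : T ⟶ G.arr} {T' : C} (p : T' ⟶ T) [IsRegularEpi p]
    (h : G.Mul (p ≫ a) (p ≫ b) (p ≫ c)) : G.Mul a b c := by
  rw [← multRel_holds] at *
  rw [← prod.comp_lift] at h
  exact Holds.descend p h

lemma eq_of_idn_mul {o : T ⟶ G.obj} {a b : T ⟶ G.arr} (h : G.Mul (o ≫ G.idn) a b) : a = b := by
  obtain ⟨h', -⟩ := id h
  have e : o = a ≫ G.tgt := by simpa [G.idn_src] using h'
  subst e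
  rw [Category.assoc] at h
  exact (idn_mul a).unique h

lemma eq_of_mul_idn {o : T ⟶ G.obj} {a b : T ⟶ G.arr} (h : G.Mul a (o ≫ G.idn) b) : a = b := by
  obtain ⟨h', -⟩ := id h
  have e : o = a ≫ G.src := by simpa [G.idn_tgt] using h'.symm
  subst e
  rw [Category.assoc] at h
  exact (mul_idn a).unique h

lemma Mul.mul_inv_cancel {a e c : T ⟶ G.arr} (h : G.Mul a e c) : G.Mul c (e ≫ G.inv) a := by
  have h2 := mul_inv e
  have h3 : G.Mul a (e ≫ G.tgt ≫ G.idn) a := by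
    have := mul_idn a
    obtain ⟨h', -⟩ := h
    rwa [← Category.assoc, h', Category.assoc] at this
  exact h.assoc' h2 h3

lemma Mul.inv_mul_cancel {e d b : T ⟶ G.arr} (h : G.Mul e d b) : G.Mul (e ≫ G.inv) b d := by
  have h2 := inv_mul e
  have h3 : G.Mul (e ≫ G.src ≫ G.idn) d d := by
    have := idn_mul d
    obtain ⟨h', -⟩ := h
    rwa [← Category.assoc, ← h', Category.assoc] at this
  exact h2.assoc h3 h

variable (G)

/-- The special dagger Frobenius structure in `Rel(C)` of an internal groupoid: its carrier is the
object of morphisms, and its multiplication and unit are the composition and the identities,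
considered as relations. -/
def toFrobenius : FrobeniusStructure C where
  carrier := G.arr
  mult := G.multRel
  unit := G.unitRel
  unit_mult := by
    apply ext_holds
    intro T x b
    rw [← lift_eta x, tensor_ident_comp_holds, graph_holds]
    generalize x ≫ prod.fst = t
    generalize x ≫ prod.snd = a
    simp only [unitRel_holds, multRel_holds, prod.lift_snd]
    constructor
    · rintro ⟨T', p, hp, _, ⟨o, rfl⟩, h⟩
      exact (cancel_epi p).1 (eq_of_idn_mul h)
    · rintro rfl
      exact ⟨T, 𝟙 _, inferInstance, a ≫ G.tgt ≫ G.idn, ⟨a ≫ G.tgt, by simp⟩,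
        by simpa using idn_mul a⟩
  mult_unit := by
    apply ext_holds
    intro T x b
    rw [← lift_eta x, ident_tensor_comp_holds, graph_holds]
    generalize x ≫ prod.fst = a
    generalize x ≫ prod.snd = t
    simp only [unitRel_holds, multRel_holds, prod.lift_fst]
    constructor
    · rintro ⟨T', p, hp, _, ⟨o, rfl⟩, h⟩
      exact (cancel_epi p).1 (eq_of_mul_idn h)
    · rintro rfl
      exact ⟨T, 𝟙 _, inferInstance, a ≫ G.src ≫ G.idn, ⟨a ≫ G.src, by simp⟩,
        by simpa using mul_idn a⟩
  assoc := by
    apply ext_holds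
    intro T x d
    obtain ⟨a, b, c, rfl⟩ : ∃ a b c, x = prod.lift (prod.lift a b) c :=
      ⟨_, _, _, by rw [lift_eta, lift_eta]⟩
    rw [associator_hom_holds, tensor_ident_comp_holds, ident_tensor_comp_holds]
    refine exists_congr fun T' => exists_congr fun p => exists_congr fun _ => ?_
    simp only [prod.comp_lift, multRel_holds]
    constructor
    · rintro ⟨e, h1, h2⟩
      obtain ⟨f, hf⟩ := exists_mul (h1.src_eq.symm.trans h2.1)
      exact ⟨f, hf, h1.assoc h2 hf⟩
    · rintro ⟨f, h1, h2⟩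
      obtain ⟨e, he⟩ := exists_mul (h2.1.trans h1.tgt_eq)
      exact ⟨e, he, he.assoc' h1 h2⟩
  special := by
    apply ext_holds
    intro T a a'
    rw [comp_holds, ident_holds]
    constructor
    · rintro ⟨T', p, hp, x, h1, h2⟩
      rw [dagger_holds] at h1
      rw [← lift_eta x, multRel_holds] at h1 h2
      exact (cancel_epi p).1 (h1.unique h2)
    · rintro rfl
      refine ⟨T, 𝟙 _, inferInstance, prod.lift a (a ≫ G.src ≫ G.idn), ?_, ?_⟩
      · rw [dagger_holds, multRel_holds]
        simpa using mul_idn a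
      · rw [multRel_holds]
        simpa using mul_idn a
  frobenius := by
    apply ext_holds
    intro T x y
    rw [← lift_eta x, ← lift_eta y, FrobeniusStructure.frobenius_left_holds,
      FrobeniusStructure.frobenius_right_holds]
    simp only [multRel_holds]
    refine exists_congr fun T' => exists_congr fun p => exists_congr fun _ => ?_
    constructor
    · rintro ⟨e, h1, h2⟩
      exact ⟨e ≫ G.inv, h1.mul_inv_cancel, h2.inv_mul_cancel⟩
    · rintro ⟨e, h1, h2⟩
      exact ⟨e ≫ G.inv, h1.mul_inv_cancel, h2.inv_mul_cancel⟩

end InternalGroupoid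

/-! ### Groupoids and relations respecting inverses -/

/-- A relation between (the objects of morphisms of) groupoids respects inverses if
`R(a, b)` implies `R(a⁻¹, b⁻¹)` and `R(id_{dom a}, id_{dom b})`. -/
def RespectsInverses (G H : InternalGroupoid C) (R : IntRel G.arr H.arr) : Prop :=
  ∀ ⦃T : C⦄ (a : T ⟶ G.arr) (b : T ⟶ H.arr), R.Holds a b →
    R.Holds (a ≫ G.inv) (b ≫ H.inv) ∧ R.Holds (a ≫ G.src ≫ G.idn) (b ≫ H.src ≫ H.idn)

lemma respectsInverses_ident (G : InternalGroupoid C) :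
    RespectsInverses G G (ident G.arr) := by
  intro T a b h
  rw [ident_holds] at *
  subst h
  simp [ident_holds]

lemma RespectsInverses.comp {G H K : InternalGroupoid C} {R : IntRel G.arr H.arr}
    {S : IntRel H.arr K.arr} (hR : RespectsInverses G H R) (hS : RespectsInverses H K S) :
    RespectsInverses G K (IntRel.comp R S) := by
  intro T a c h
  obtain ⟨T', p, hp, b, h1, h2⟩ := (comp_holds _ _ _ _).1 h
  constructor
  · apply Holds.descend p
    simpa using comp_holds_of _ (hR _ _ h1).1 (hS _ _ h2).1
  · apply Holds.descend p
    simpa using comp_holds_of _ (hR _ _ h1).2 (hS _ _ h2).2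

end

/-- The objects of the category of groupoids and relations respecting inverses: the internal
groupoids in `C`. -/
structure InverseRelCat (C : Type u) [Category.{v} C] [HasFiniteLimits C] where
  /-- The underlying groupoid. -/
  of : InternalGroupoid C

/-- A morphism of groupoids: a relation respecting inverses. -/
@[ext]
structure InverseRelHom {C : Type u} [Category.{v} C] [Regular C] (G H : InternalGroupoid C) where
  /-- The underlying relation. -/
  rel : IntRel G.arr H.arr
  respectsInverses : RespectsInverses G H rel

/-- The category of groupoids and relations in `C` that respect inverses. -/
instance (C : Type u) [Category.{v} C] [Regular C] : Category.{max u v} (InverseRelCat C) where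
  Hom G H := InverseRelHom G.of H.of
  id G := ⟨IntRel.ident G.of.arr, respectsInverses_ident G.of⟩
  comp R S := ⟨IntRel.comp R.rel S.rel, R.respectsInverses.comp S.respectsInverses⟩
  id_comp R := InverseRelHom.ext (IntRel.ident_comp R.rel)
  comp_id R := InverseRelHom.ext (IntRel.comp_ident R.rel)
  assoc R S Q := InverseRelHom.ext (IntRel.comp_assoc R.rel S.rel Q.rel)

/-! ### Comparison functors -/

/-- The image of a relation under a functor: the relation represented by the image of the span
representing `R`. -/
def IntRel.mapFunctor {D : Type u} [Category.{v} D] [HasFiniteLimits D] {D' : Type u'}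
    [Category.{v'} D'] [Regular D'] (F : D ⥤ D') {A B : D} (R : IntRel A B) :
    IntRel (F.obj A) (F.obj B) :=
  IntRel.ofSpan (F.map R.fst) (F.map R.snd)

/-- A functor between regular categories acts functorially on relations. -/
structure IsFunctorialOnRelations {D : Type u} [Category.{v} D] [Regular D] {D' : Type u'}
    [Category.{v'} D'] [Regular D'] (F : D ⥤ D') : Prop where
  map_ident : ∀ A : D, IntRel.mapFunctor F (IntRel.ident A) = IntRel.ident (F.obj A)
  map_comp : ∀ ⦃A B E : D⦄ (R : IntRel A B) (S : IntRel B E),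
    IntRel.mapFunctor F (IntRel.comp R S) =
      IntRel.comp (IntRel.mapFunctor F R) (IntRel.mapFunctor F S)

/-- The functor `Rel(D) ⥤ Rel(D')` induced by a functor `D ⥤ D'` acting functorially on
relations. -/
def relationFunctor {D : Type u} [Category.{v} D] [Regular D] {D' : Type u'}
    [Category.{v'} D'] [Regular D'] (F : D ⥤ D') (h : IsFunctorialOnRelations F) :
    RelationCat D ⥤ RelationCat D' where
  obj A := ⟨F.obj A.of⟩
  map R := IntRel.mapFunctor F R
  map_id A := h.map_ident A.of
  map_comp R S := h.map_comp R S

/-- The functor from `Rel(Gpd(C))` to the category of groupoids and relations respecting inverses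
that is the identity on objects and sends a relation between groupoids to the underlying relation
between their objects of morphisms. -/
def forgetToInverseRel (C : Type u) [Category.{v} C] [Regular C] [Regular (InternalGroupoid C)]
    (h : IsFunctorialOnRelations (groupoidArrows C))
    (h' : ∀ ⦃G H : InternalGroupoid C⦄ (R : IntRel G H),
      RespectsInverses G H (IntRel.mapFunctor (groupoidArrows C) R)) :
    RelationCat (InternalGroupoid C) ⥤ InverseRelCat C where
  obj G := ⟨G.of⟩
  map R := ⟨IntRel.mapFunctor (groupoidArrows C) R, h' R⟩
  map_id G := InverseRelHom.ext (h.map_ident G.of)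
  map_comp R S := InverseRelHom.ext (h.map_comp R S)

/-- The functor from the category of groupoids and relations respecting inverses to `CP(Rel(C))`
that sends a groupoid to its Frobenius structure and is the identity on relations. -/
def inverseRelToCP (C : Type u) [Category.{v} C] [Regular C]
    (h : ∀ ⦃G H : InternalGroupoid C⦄ (R : IntRel G.arr H.arr), RespectsInverses G H R →
      IsCompletelyPositive G.toFrobenius H.toFrobenius R) :
    InverseRelCat C ⥤ FrobeniusStructure C where
  obj G := G.of.toFrobenius
  map R := ⟨R.rel, h R.rel R.respectsInverses⟩
  map_id _ := rfl
  map_comp _ _ := rfl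

end CPRel

end

noncomputable section

namespace CPRel

attribute [local simp] prod.lift_fst prod.lift_snd prod.lift_fst_assoc prod.lift_snd_assoc
  prod.comp_lift prod.map_fst prod.map_snd prod.map_fst_assoc prod.map_snd_assoc
  pullback.lift_fst pullback.lift_snd pullback.lift_fst_assoc pullback.lift_snd_assoc

/-! ### Generalized elements of relations -/

/-! Everything is computed with generalized elements. Relations are predicates stable under pullback
and descending along regular epimorphisms, existential quantifiers are witnessed on a cover, and a
locally given element that is unique descends to a global one.

An equivalence relation `R` equals `R† ∘ R`, which gives the first claim.

For groupoids, the Choi matrix of `R` relates `(a, b)` to `(a', b')` exactly when `R(a'⁻¹a, b'b⁻¹)`.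
It is symmetric and reflexive on its domain if `R` respects inverses. Positive regularity, extended
to relations that are reflexive only on their domain (`IsPositivelyRegular.isPositive`), then makes
it positive. Conversely a positive relation is symmetric and reflexive on its domain, and evaluating
the Choi matrix at identities returns closure of `R` under inverses and identities. So `E` is full
and faithful. It is essentially surjective because a special dagger Frobenius structure is a
groupoid: speciality makes multiplication single-valued, the unit laws give sources and targets, and
the Frobenius law gives composites and inverses (`FrobeniusStructure.presentation`).

If `C` is Mal'cev, every relation is difunctional. Applied to the Choi matrix, this shows that a
relation respecting inverses is closed under composition (`RespectsInverses.isMultiplicative`), so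
its elements form a groupoid and `U` is full. The same fact, applied to images and graphs of
functors, shows that covers of groupoids are exactly the functors that are covers on arrows, whence
`Gpd(C)` is regular. Internal categories have inverses by symmetry of a divisibility relation, so
`Gpd(C)` and `Cat(C)` are equivalent, and so are their categories of relations.

Conversely, a relation in `Gpd(C)` has an underlying relation closed under composition. If `E ∘ U`
is full, all relations respecting inverses are therefore closed under composition. A reflexive
symmetric relation `S` on `A`, seen as a partial identity on the arrows of the indiscrete groupoid
on `A`, respects inverses; closure under composition is transitivity of `S`. That suffices for
Mal'cev (`isMalcev_of_transitive`). -/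

/-- A morphism defined on a cover descends if it takes equal values on equal elements. -/
lemma exists_descend {C : Type u} [Category.{v} C] {T T' X : C} (p : T' ⟶ T) [IsRegularEpi p]
    (x : T' ⟶ X) (h : ∀ ⦃W : C⦄ (s t : W ⟶ T'), s ≫ p = t ≫ p → s ≫ x = t ≫ x) :
    ∃ y : T ⟶ X, p ≫ y = x :=
  ⟨IsRegularEpi.desc p x (h _ _ (IsRegularEpi.w p)), IsRegularEpi.fac p x _⟩

section FiniteLimits

variable {C : Type u} [Category.{v} C] [HasFiniteLimits C]

namespace IntRel

variable {A B : C} {R : IntRel A B}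

lemma lift_fst_snd (R : IntRel A B) : prod.lift R.fst R.snd = R.arrow := by
  ext <;> simp [fst, snd]

lemma hom_ext {T : C} {x y : T ⟶ (R : C)} (h₁ : x ≫ R.fst = y ≫ R.fst)
    (h₂ : x ≫ R.snd = y ≫ R.snd) : x = y := by
  rw [← cancel_mono R.arrow, ← lift_fst_snd, prod.comp_lift, prod.comp_lift, h₁, h₂]

/-- The element of a relation given by two related elements. -/
def lift {T : C} (a : T ⟶ A) (b : T ⟶ B) (h : R.Holds a b) : T ⟶ (R : C) :=
  Subobject.factorThru R _ h

lemma lift_arrow {T : C} (a : T ⟶ A) (b : T ⟶ B) (h : R.Holds a b) :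
    lift a b h ≫ R.arrow = prod.lift a b :=
  Subobject.factorThru_arrow _ _ h

@[simp]
lemma lift_fst {T : C} (a : T ⟶ A) (b : T ⟶ B) (h : R.Holds a b) : lift a b h ≫ R.fst = a := by
  rw [fst, ← Category.assoc, lift_arrow, prod.lift_fst]

@[simp]
lemma lift_snd {T : C} (a : T ⟶ A) (b : T ⟶ B) (h : R.Holds a b) : lift a b h ≫ R.snd = b := by
  rw [snd, ← Category.assoc, lift_arrow, prod.lift_snd]

@[simp]
lemma lift_fst_assoc {T X : C} (a : T ⟶ A) (b : T ⟶ B) (h : R.Holds a b) (f : A ⟶ X) :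
    lift a b h ≫ R.fst ≫ f = a ≫ f := by
  rw [← Category.assoc, lift_fst]

@[simp]
lemma lift_snd_assoc {T X : C} (a : T ⟶ A) (b : T ⟶ B) (h : R.Holds a b) (f : B ⟶ X) :
    lift a b h ≫ R.snd ≫ f = b ≫ f := by
  rw [← Category.assoc, lift_snd]

lemma holds_fst_snd (R : IntRel A B) : R.Holds R.fst R.snd := by
  unfold Holds
  rw [lift_fst_snd]
  exact Subobject.factors_self R

lemma holds_comp {T : C} (x : T ⟶ (R : C)) : R.Holds (x ≫ R.fst) (x ≫ R.snd) :=
  R.holds_fst_snd.pull x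

/-- The inverse image of a relation along a pair of morphisms. -/
def inverseImage {A' B' : C} (f : A' ⟶ A) (g : B' ⟶ B) (R : IntRel A B) : IntRel A' B' :=
  (Subobject.pullback (prod.map f g)).obj R

lemma inverseImage_holds {A' B' : C} (f : A' ⟶ A) (g : B' ⟶ B) {T : C} (a : T ⟶ A')
    (b : T ⟶ B') : (inverseImage f g R).Holds a b ↔ R.Holds (a ≫ f) (b ≫ g) := by
  unfold Holds inverseImage
  rw [pullback_factors_iff]
  simp

/-- A relation is difunctional if `R(x, y)`, `R(z, y)` and `R(z, w)` imply `R(x, w)`. -/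
def Difunctional (R : IntRel A B) : Prop :=
  ∀ ⦃T : C⦄ ⦃x z : T ⟶ A⦄ ⦃y w : T ⟶ B⦄, R.Holds x y → R.Holds z y → R.Holds z w → R.Holds x w

end IntRel

/-! ### Criteria for Mal'cev categories -/

open IntRel

/-- On the object of pairs `(a, b)` with `R(a, b)`, the relation `(a, b) ~ (a', b')` given by `R(a,
b')` is reflexive. Its transitivity along `(x, y) ~ (z, y) ~ (z, w)` is difunctionality. -/
lemma IsMalcev.difunctional (h : IsMalcev C) {A B : C} (R : IntRel A B) : R.Difunctional := by
  intro T x z y w hxy hzy hzw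
  have h₁ := (h (inverseImage R.fst R.snd R) ((inverseImage_holds _ _ _ _).2
    (by simpa using R.holds_fst_snd))).2 (lift x y hxy) (lift z y hzy) (lift z w hzw)
    ((inverseImage_holds _ _ _ _).2 (by simpa using hxy))
    ((inverseImage_holds _ _ _ _).2 (by simpa using hzw))
  simpa using (inverseImage_holds _ _ _ _).1 h₁

/-- Symmetry is the chain `R(b, b)`, `R(a, b)`, `R(a, a)`; transitivity is the chain `R(a, b)`,
`R(b, b)`, `R(b, c)`. -/
lemma isMalcev_of_difunctional
    (h : ∀ ⦃A B : C⦄ (R : IntRel A B), R.Difunctional) : IsMalcev C := by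
  intro A R hR
  have hr {T : C} (a : T ⟶ A) : R.Holds a a := by simpa using Holds.pull hR a
  exact ⟨fun T a b => ⟨fun k => h R (hr b) k (hr a), fun k => h R (hr a) k (hr b)⟩,
    fun T a b c h₁ h₂ => h R h₁ (hr b) h₂⟩

/-- A category is a Mal'cev category as soon as its reflexive symmetric relations are transitive:
apply this to the relation `R(a, b') ∧ R(a', b)` on the object of pairs `(a, b)` related by `R`. -/
lemma isMalcev_of_transitive
    (h : ∀ ⦃A : C⦄ (R : IntRel A A), R.Reflexive → R.Symmetric → R.Transitive) : IsMalcev C := by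
  refine isMalcev_of_difunctional fun A B R T x z y w hxy hzy hzw => ?_
  let S : IntRel (R : C) (R : C) :=
    inverseImage R.fst R.snd R ⊓ dagger (inverseImage R.fst R.snd R)
  have hS {T : C} (a b : T ⟶ (R : C)) :
      S.Holds a b ↔ R.Holds (a ≫ R.fst) (b ≫ R.snd) ∧ R.Holds (b ≫ R.fst) (a ≫ R.snd) := by
    rw [← inverseImage_holds, ← inverseImage_holds, ← dagger_holds _ a]
    unfold Holds S
    rw [Subobject.inf_factors]
  -- The chain is `(x, y) ~ (z, y) ~ (z, w)`; both steps have `R(z, y)` as the reversed condition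
  -- that symmetrization adds.
  have h₁ := h S ((hS _ _).2 (by simpa using R.holds_fst_snd))
    (fun T a b => by rw [hS, hS, and_comm]) (lift x y hxy) (lift z y hzy) (lift z w hzw)
    ((hS _ _).2 (by simpa using ⟨hxy, hzy⟩)) ((hS _ _).2 (by simpa using ⟨hzw, hzy⟩))
  simpa using ((hS _ _).1 h₁).1

end FiniteLimits

/-! ### Positive relations -/

section RegularCategory

variable {C : Type u} [Category.{v} C] [Regular C]

open IntRel

/-- An equivalence relation is its own square root: `R = R† ∘ R`, with reflexivity for one inclusion
and symmetry and transitivity for the other. -/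
lemma IsMalcev.isPositivelyRegular (h : IsMalcev C) : IsPositivelyRegular C := by
  intro A R hR hs
  refine ⟨A, R, ext_holds fun T a b => ⟨fun k => ?_, fun k => ?_⟩⟩
  · exact comp_holds_of b k ((dagger_holds _ _ _).2 (by simpa using Holds.pull hR b))
  · obtain ⟨T', p, hp, c, h₁, h₂⟩ := (comp_holds _ _ _ _).1 k
    rw [dagger_holds, hs] at h₂
    exact ((h R hR).2 _ _ _ h₁ h₂).descend p

/-- If `R(a, -)` is locally inhabited and `R` is single-valued at `a` then `R(a, -)` is
inhabited. -/
lemma IntRel.exists_holds_of_unique {A B T : C} (R : IntRel A B) (a : T ⟶ A)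
    (h : ∃ (T' : C) (p : T' ⟶ T) (_ : IsRegularEpi p) (b : T' ⟶ B), R.Holds (p ≫ a) b)
    (hu : ∀ ⦃W : C⦄ (t : W ⟶ T) (b b' : W ⟶ B), R.Holds (t ≫ a) b → R.Holds (t ≫ a) b' → b = b') :
    ∃ b : T ⟶ B, R.Holds a b := by
  obtain ⟨T', p, hp, b, hb⟩ := h
  obtain ⟨y, rfl⟩ := exists_descend p b fun W s t hst => hu (s ≫ p) _ _
    (by simpa using hb.pull s) (by rw [hst]; simpa using hb.pull t)
  exact ⟨y, hb.descend p⟩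

lemma IntRel.ofSpan_holds_self {X A B T : C} (f : X ⟶ A) (g : X ⟶ B) (x : T ⟶ X) :
    (ofSpan f g).Holds (x ≫ f) (x ≫ g) :=
  (ofSpan_holds _ _ _ _).2 ⟨T, 𝟙 T, inferInstance, x, by simp⟩

lemma IntRel.IsPositive.symmetric {A : C} {R : IntRel A A} (h : R.IsPositive) : R.Symmetric := by
  obtain ⟨X, S, rfl⟩ := h
  have key {T : C} (a b : T ⟶ A) (k : (comp S (dagger S)).Holds a b) :
      (comp S (dagger S)).Holds b a := by
    obtain ⟨T', p, hp, c, h₁, h₂⟩ := (comp_holds _ _ _ _).1 k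
    rw [dagger_holds] at h₂
    exact (comp_holds _ _ _ _).2 ⟨T', p, hp, c, h₂, (dagger_holds _ _ _).2 h₁⟩
  exact fun T a b => ⟨key a b, key b a⟩

lemma IntRel.IsPositive.holds_self {A : C} {R : IntRel A A} (h : R.IsPositive) {T : C}
    {a b : T ⟶ A} (k : R.Holds a b) : R.Holds a a := by
  obtain ⟨X, S, rfl⟩ := h
  obtain ⟨T', p, hp, c, h₁, h₂⟩ := (comp_holds _ _ _ _).1 k
  exact (comp_holds _ _ _ _).2 ⟨T', p, hp, c, h₁, (dagger_holds _ _ _).2 h₁⟩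

/-- In a positively regular category, a symmetric relation that is reflexive on a subobject
containing its domain is positive. -/
lemma IsPositivelyRegular.isPositive (hC : IsPositivelyRegular C) {A D : C} (R : IntRel A A)
    (hs : R.Symmetric) (d : D ⟶ A) (hd : R.Holds d d)
    (hR : ∀ ⦃T : C⦄ (a b : T ⟶ A), R.Holds a b → ∃ c : T ⟶ D, c ≫ d = a) : R.IsPositive := by
  obtain ⟨X, S, hS⟩ := hC (inverseImage d d R) ((inverseImage_holds _ _ _ _).2 (by simpa using hd))
    (fun T a b => by rw [inverseImage_holds, inverseImage_holds, hs])
  -- The restriction of `R` along `d` is `S† ∘ S`. Precomposing `S` with the converse of the graph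
  -- of `d` transports this square root back to `A`; nothing is lost, because by symmetry both the
  -- domain and the range of `R` lie in the image of `d`.
  refine ⟨X, comp (dagger (graph d)) S, ext_holds fun T a b => ⟨fun h => ?_, fun h => ?_⟩⟩
  · obtain ⟨c, rfl⟩ := hR a b h
    obtain ⟨e, rfl⟩ := hR b _ ((hs _ _).1 h)
    rw [← inverseImage_holds, hS, comp_holds] at h
    obtain ⟨T', p, hp, x, h₁, h₂⟩ := h
    rw [dagger_holds] at h₂
    refine (comp_holds _ _ _ _).2 ⟨T', p, hp, x, ?_, (dagger_holds _ _ _).2 ?_⟩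
    · exact comp_holds_of (p ≫ c) ((dagger_holds _ _ _).2 ((graph_holds _ _ _).2 (by simp))) h₁
    · exact comp_holds_of (p ≫ e) ((dagger_holds _ _ _).2 ((graph_holds _ _ _).2 (by simp))) h₂
  · obtain ⟨T₁, p, hp, x, h₁, h₂⟩ := (comp_holds _ _ _ _).1 h
    obtain ⟨T₂, q, hq, c, h₃, h₄⟩ := (comp_holds _ _ _ _).1 h₁
    rw [dagger_holds] at h₂
    obtain ⟨T₃, r, hr, e, h₅, h₆⟩ := (comp_holds _ _ _ _).1 (h₂.pull q)
    rw [dagger_holds, graph_holds] at h₃ h₅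
    apply Holds.descend (r ≫ q ≫ p)
    have h₇ := comp_holds_of _ (h₄.pull r) ((dagger_holds _ _ _).2 h₆)
    rw [← hS, inverseImage_holds] at h₇
    simpa [h₃, h₅] using h₇

end RegularCategory

/-! ### Completely positive relations between groupoids -/

section RegularCategory

variable {C : Type u} [Category.{v} C] [Regular C]

open IntRel

namespace InternalGroupoid

variable {G H : InternalGroupoid C} {T : C}

lemma Mul.comp_eq {a b c : T ⟶ G.arr} (h : G.Mul a b c) : a ≫ G.src = b ≫ G.tgt := h.1

lemma Mul.left_unique {a b x y : T ⟶ G.arr} (h : G.Mul x a b) (h' : G.Mul y a b) : x = y :=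
  h.mul_inv_cancel.unique h'.mul_inv_cancel

lemma Mul.right_unique {a b x y : T ⟶ G.arr} (h : G.Mul a x b) (h' : G.Mul a y b) : x = y :=
  h.inv_mul_cancel.unique h'.inv_mul_cancel

lemma Mul.eq_inv {a b : T ⟶ G.arr} {o : T ⟶ G.obj} (h : G.Mul a b (o ≫ G.idn)) :
    b = a ≫ G.inv := by
  have h₁ := h.inv_mul_cancel
  exact (eq_of_mul_idn h₁).symm

end InternalGroupoid

open InternalGroupoid

variable {G H : InternalGroupoid C}

lemma choi_multRel_holds (R : IntRel G.arr H.arr) {T : C} (a a' : T ⟶ G.arr) (b b' : T ⟶ H.arr) :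
    (choi G.multRel H.multRel R).Holds (prod.lift a b) (prod.lift a' b') ↔
      ∃ (T' : C) (p : T' ⟶ T) (_ : IsRegularEpi p) (x : T' ⟶ G.arr) (y : T' ⟶ H.arr),
        G.Mul (p ≫ a') x (p ≫ a) ∧ R.Holds x y ∧ H.Mul y (p ≫ b) (p ≫ b') := by
  rw [choi_holds]
  simp only [multRel_holds]

lemma choi_multRel_holds_of {R : IntRel G.arr H.arr} {T : C} {a a' x : T ⟶ G.arr}
    {b b' y : T ⟶ H.arr} (h₁ : G.Mul a' x a) (h : R.Holds x y) (h₂ : H.Mul y b b') :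
    (choi G.multRel H.multRel R).Holds (prod.lift a b) (prod.lift a' b') :=
  (choi_multRel_holds _ _ _ _ _).2
    ⟨T, 𝟙 T, inferInstance, x, y, by simpa using h₁, h, by simpa using h₂⟩

/-- Cancellation in a groupoid forces `x = a'⁻¹a` and `y = b'b⁻¹`, so the witnesses hidden in the
Choi matrix are the given ones and `R` can be read off from its entries. -/
lemma holds_of_choi_multRel_holds {R : IntRel G.arr H.arr} {T : C} {a a' x : T ⟶ G.arr}
    {b b' y : T ⟶ H.arr} (h₁ : G.Mul a' x a) (h₂ : H.Mul y b b')
    (h : (choi G.multRel H.multRel R).Holds (prod.lift a b) (prod.lift a' b')) :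
    R.Holds x y := by
  obtain ⟨T', p, hp, x', y', h₃, h₄, h₅⟩ := (choi_multRel_holds _ _ _ _ _).1 h
  rw [← (h₁.pull p).right_unique h₃, ← (h₂.pull p).left_unique h₅] at h₄
  exact h₄.descend p

/-- In a positively regular category, relations respecting inverses are completely positive. -/
lemma RespectsInverses.isCompletelyPositive (hC : IsPositivelyRegular C) {R : IntRel G.arr H.arr}
    (hR : RespectsInverses G H R) : IsCompletelyPositive G.toFrobenius H.toFrobenius R := by
  change (choi G.multRel H.multRel R).IsPositive
  have key {T : C} (a b : T ⟶ G.arr ⨯ H.arr) (h : (choi G.multRel H.multRel R).Holds a b) :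
      (choi G.multRel H.multRel R).Holds b a := by
    rw [← lift_eta a, ← lift_eta b, choi_multRel_holds] at h
    rw [← lift_eta a, ← lift_eta b, choi_multRel_holds]
    obtain ⟨T', p, hp, x, y, h₁, h₂, h₃⟩ := h
    exact ⟨T', p, hp, _, _, h₁.mul_inv_cancel, (hR _ _ h₂).1, h₃.inv_mul_cancel⟩
  -- The pairs `(a, b)` with `R(a⁻¹a, bb⁻¹)`, that is, those which the Choi matrix relates to
  -- themselves.
  let D := inverseImage (G.src ≫ G.idn) (H.tgt ≫ H.idn) R
  refine hC.isPositive _ (fun T a b => ⟨key a b, key b a⟩) D.arrow ?_ fun T a b h => ?_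
  · have h := D.holds_fst_snd
    rw [inverseImage_holds] at h
    rw [← lift_fst_snd]
    exact choi_multRel_holds_of (mul_idn _) h (idn_mul _)
  · have hD : D.Holds (a ≫ prod.fst) (a ≫ prod.snd) := by
      rw [inverseImage_holds]
      rw [← lift_eta a, ← lift_eta b, choi_multRel_holds] at h
      obtain ⟨T', p, hp, x, y, h₁, h₂, h₃⟩ := h
      -- From `a = a'x` and `b' = yb` one has `src x = src a` and `src y = tgt b`, so the identities
      -- at the sources of `x` and `y` are those occurring in `D`.
      have h₄ := (hR _ _ h₂).2
      rw [← Category.assoc, ← Category.assoc, ← h₁.src_eq, h₃.1] at h₄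
      exact Holds.descend p (by simpa using h₄)
    exact ⟨lift _ _ hD, by rw [lift_arrow, lift_eta]⟩

/-- If `R(a, b)` then the Choi matrix relates `(a, 1)` to `(1, b)`. Positivity provides the reversed
entry, which reads `R(a⁻¹, b⁻¹)`, and the diagonal entry at `(a, 1)`, which reads `R(1, 1)` at the
sources of `a` and `b`. -/
lemma IsCompletelyPositive.respectsInverses {R : IntRel G.arr H.arr}
    (hR : IsCompletelyPositive G.toFrobenius H.toFrobenius R) : RespectsInverses G H R := by
  change (choi G.multRel H.multRel R).IsPositive at hR
  intro T a b h
  have h₁ := choi_multRel_holds_of (idn_mul a) h (mul_idn b)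
  refine ⟨holds_of_choi_multRel_holds (mul_inv a) (inv_mul b) ((hR.symmetric _ _).1 h₁), ?_⟩
  refine holds_of_choi_multRel_holds (mul_idn a) ?_ (hR.holds_self h₁)
  simpa [reassoc_of% H.idn_tgt] using idn_mul (b ≫ H.src ≫ H.idn)

end RegularCategory

/-! ### Groupoids presented by the graph of their composition -/

section RegularCategory

variable {C : Type u} [Category.{v} C] [Regular C]

open IntRel

variable (C) in
/-- An internal groupoid presented by its composition as a ternary predicate on generalized
elements. -/
structure GroupoidPresentation where
  /-- The object of objects. -/
  obj : C
  /-- The object of morphisms. -/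
  arr : C
  /-- The source. -/
  src : arr ⟶ obj
  /-- The target. -/
  tgt : arr ⟶ obj
  /-- The identities. -/
  idn : obj ⟶ arr
  /-- The inversion. -/
  inv : arr ⟶ arr
  /-- `Mul a b c` says that `c` is the composite of `a` and `b`. -/
  Mul : ∀ ⦃T : C⦄, (T ⟶ arr) → (T ⟶ arr) → (T ⟶ arr) → Prop
  idn_src : idn ≫ src = 𝟙 obj
  idn_tgt : idn ≫ tgt = 𝟙 obj
  mul_pull : ∀ ⦃T T' : C⦄ (p : T' ⟶ T) (a b c : T ⟶ arr), Mul a b c →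
    Mul (p ≫ a) (p ≫ b) (p ≫ c)
  mul_comp : ∀ ⦃T : C⦄ (a b c : T ⟶ arr), Mul a b c → a ≫ src = b ≫ tgt
  mul_src : ∀ ⦃T : C⦄ (a b c : T ⟶ arr), Mul a b c → c ≫ src = b ≫ src
  mul_tgt : ∀ ⦃T : C⦄ (a b c : T ⟶ arr), Mul a b c → c ≫ tgt = a ≫ tgt
  mul_unique : ∀ ⦃T : C⦄ (a b c c' : T ⟶ arr), Mul a b c → Mul a b c' → c = c'
  exists_mul : ∀ ⦃T : C⦄ (a b : T ⟶ arr), a ≫ src = b ≫ tgt → ∃ c, Mul a b c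
  idn_mul : Mul (tgt ≫ idn) (𝟙 arr) (𝟙 arr)
  mul_idn : Mul (𝟙 arr) (src ≫ idn) (𝟙 arr)
  mul_assoc : ∀ ⦃T : C⦄ (a b c e d f : T ⟶ arr), Mul a b e → Mul e c d → Mul b c f → Mul a f d
  inv_mul : Mul inv (𝟙 arr) (src ≫ idn)
  mul_inv : Mul (𝟙 arr) inv (tgt ≫ idn)

namespace GroupoidPresentation

variable (P : GroupoidPresentation C)

/-- The composition of a presented groupoid. -/
def m : pullback P.src P.tgt ⟶ P.arr :=
  (P.exists_mul (pullback.fst P.src P.tgt) (pullback.snd P.src P.tgt) pullback.condition).choose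

lemma mul_m : P.Mul (pullback.fst P.src P.tgt) (pullback.snd P.src P.tgt) P.m :=
  (P.exists_mul (pullback.fst P.src P.tgt) (pullback.snd P.src P.tgt)
    pullback.condition).choose_spec

variable {P} in
lemma mul_lift_m {T : C} {a b : T ⟶ P.arr} (h : a ≫ P.src = b ≫ P.tgt) :
    P.Mul a b (pullback.lift a b h ≫ P.m) := by
  simpa using P.mul_pull (pullback.lift a b h) _ _ _ P.mul_m

variable {P} in
lemma lift_m_eq {T : C} {a b c : T ⟶ P.arr} (h : P.Mul a b c) (h') :
    pullback.lift a b h' ≫ P.m = c :=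
  P.mul_unique _ _ _ _ (mul_lift_m h') h

/-- The groupoid given by a presentation. -/
def toGroupoid : InternalGroupoid C where
  obj := P.obj
  arr := P.arr
  src := P.src
  tgt := P.tgt
  idn := P.idn
  m := P.m
  idn_src := P.idn_src
  idn_tgt := P.idn_tgt
  m_src := P.mul_src _ _ _ P.mul_m
  m_tgt := P.mul_tgt _ _ _ P.mul_m
  idn_m := lift_m_eq P.idn_mul _
  m_idn := lift_m_eq P.mul_idn _
  assoc T a b c hab hbc := by
    refine (lift_m_eq ?_ _).symm
    exact P.mul_assoc _ _ _ _ _ _ (mul_lift_m hab) (mul_lift_m _) (mul_lift_m hbc)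
  inv := P.inv
  inv_src := by simpa using P.mul_comp _ _ _ P.inv_mul
  inv_tgt := by simpa using (P.mul_comp _ _ _ P.mul_inv).symm
  inv_m := lift_m_eq P.inv_mul _
  m_inv := lift_m_eq P.mul_inv _

lemma toGroupoid_mul {T : C} (a b c : T ⟶ P.arr) :
    P.toGroupoid.Mul a b c ↔ P.Mul a b c := by
  constructor
  · rintro ⟨h, rfl⟩
    exact mul_lift_m h
  · exact fun h => ⟨P.mul_comp _ _ _ h, lift_m_eq h _⟩

end GroupoidPresentation

/-! ### Special dagger Frobenius structures are groupoids -/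

namespace FrobeniusStructure

open InternalGroupoid (multRel_holds unitRel_holds)

variable {F : FrobeniusStructure C} {T : C}

/-- This is the special law: `μ ∘ μ†` relates any two products of the same pair. -/
lemma M.unique {a b c c' : T ⟶ F.carrier} (h : F.M a b c) (h' : F.M a b c') : c = c' := by
  have hs : (comp (dagger F.mult) F.mult).Holds c c' :=
    comp_holds_of (prod.lift a b) ((dagger_holds _ _ _).2 h) h'
  rwa [F.special, ident_holds] at hs

lemma U.descend {x : T ⟶ F.carrier} {T' : C} (p : T' ⟶ T) [IsRegularEpi p] (h : F.U (p ≫ x)) :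
    F.U x := by
  unfold U at *
  rw [← Subsingleton.elim (p ≫ terminal.from T) (terminal.from T')] at h
  exact Holds.descend p h

/-- Here `b = a`, and reassociating `(a u) u'` shows that `u u'` is locally defined; the unit laws
make this product equal to both `u` and `u'`. -/
lemma U.eq_of_mul_left {a b u u' : T ⟶ F.carrier} (hu : F.U u) (hu' : F.U u') (h : F.M a u b)
    (h' : F.M a u' b) : u = u' := by
  obtain rfl := eq_of_unit_right hu h
  obtain ⟨T', p, hp, f, h₁, -⟩ := assoc_mp h h'
  rw [← cancel_epi p]
  exact (eq_of_unit_right (hu'.pull p) h₁).trans (eq_of_unit_left (hu.pull p) h₁).symm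

lemma U.eq_of_mul_right {a b u u' : T ⟶ F.carrier} (hu : F.U u) (hu' : F.U u') (h : F.M u a b)
    (h' : F.M u' a b) : u = u' := by
  obtain rfl := eq_of_unit_left hu h
  obtain ⟨T', p, hp, f, h₁, -⟩ := assoc_mpr h' h
  rw [← cancel_epi p]
  exact (eq_of_unit_right (hu'.pull p) h₁).trans (eq_of_unit_left (hu.pull p) h₁).symm

/-- A unit, as a generalized element of the object of units. -/
def U.lift {x : T ⟶ F.carrier} (h : F.U x) : T ⟶ (F.unit : C) := IntRel.lift _ _ h

@[simp]
lemma U.lift_snd {x : T ⟶ F.carrier} (h : F.U x) : h.lift ≫ F.unit.snd = x :=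
  IntRel.lift_snd _ _ h

lemma U_snd (o : T ⟶ (F.unit : C)) : F.U (o ≫ F.unit.snd) := by
  have h := F.unit.holds_comp o
  rwa [Subsingleton.elim (o ≫ F.unit.fst) (terminal.from T)] at h

lemma unit_hom_ext {o o' : T ⟶ (F.unit : C)} (h : o ≫ F.unit.snd = o' ≫ F.unit.snd) : o = o' :=
  IntRel.hom_ext (Subsingleton.elim _ _) h

variable (F)

/-- The unit law provides a right unit on a cover, and its uniqueness makes it descend. -/
lemma exists_src : ∃ s : F.carrier ⟶ (F.unit : C), F.M (𝟙 _) (s ≫ F.unit.snd) (𝟙 _) := by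
  obtain ⟨T, p, hp, x, hx, h⟩ := exists_unit_right (𝟙 F.carrier)
  obtain ⟨y, hy⟩ := exists_descend p x fun W s t hst => by
    have h₁ := h.pull s
    have h₂ := h.pull t
    simp only [Category.comp_id] at h₁ h₂
    rw [hst] at h₁
    exact (hx.pull s).eq_of_mul_left (hx.pull t) h₁ h₂
  have hU : F.U y := by
    subst hy
    exact hx.descend p
  exact ⟨hU.lift, M.descend p (by simpa [hy] using h)⟩

lemma exists_tgt : ∃ t : F.carrier ⟶ (F.unit : C), F.M (t ≫ F.unit.snd) (𝟙 _) (𝟙 _) := by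
  obtain ⟨T, p, hp, x, hx, h⟩ := exists_unit_left (𝟙 F.carrier)
  obtain ⟨y, hy⟩ := exists_descend p x fun W s t hst => by
    have h₁ := h.pull s
    have h₂ := h.pull t
    simp only [Category.comp_id] at h₁ h₂
    rw [hst] at h₁
    exact (hx.pull s).eq_of_mul_right (hx.pull t) h₁ h₂
  have hU : F.U y := by
    subst hy
    exact hx.descend p
  exact ⟨hU.lift, M.descend p (by simpa [hy] using h)⟩

/-- The source of the groupoid of a Frobenius structure. -/
def src : F.carrier ⟶ (F.unit : C) := F.exists_src.choose

/-- The target of the groupoid of a Frobenius structure. -/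
def tgt : F.carrier ⟶ (F.unit : C) := F.exists_tgt.choose

lemma src_spec : F.M (𝟙 _) (F.src ≫ F.unit.snd) (𝟙 _) := F.exists_src.choose_spec

lemma tgt_spec : F.M (F.tgt ≫ F.unit.snd) (𝟙 _) (𝟙 _) := F.exists_tgt.choose_spec

variable {F}

lemma mul_src (a : T ⟶ F.carrier) : F.M a (a ≫ F.src ≫ F.unit.snd) a := by
  simpa using F.src_spec.pull a

lemma tgt_mul (a : T ⟶ F.carrier) : F.M (a ≫ F.tgt ≫ F.unit.snd) a a := by
  simpa using F.tgt_spec.pull a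

lemma eq_src {a : T ⟶ F.carrier} {o : T ⟶ (F.unit : C)} (h : F.M a (o ≫ F.unit.snd) a) :
    a ≫ F.src = o :=
  unit_hom_ext ((U_snd _).eq_of_mul_left (U_snd o) (by simpa using mul_src a) h)

lemma eq_tgt {a : T ⟶ F.carrier} {o : T ⟶ (F.unit : C)} (h : F.M (o ≫ F.unit.snd) a a) :
    a ≫ F.tgt = o :=
  unit_hom_ext ((U_snd _).eq_of_mul_right (U_snd o) (by simpa using tgt_mul a) h)

/-- Reassociating `a (1 b)`, with `1` the identity at `tgt b`, shows that `a 1` is defined, hence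
equal to `a`; so `1` is also the right unit of `a`. -/
lemma M.comp_eq {a b c : T ⟶ F.carrier} (h : F.M a b c) : a ≫ F.src = b ≫ F.tgt := by
  obtain ⟨T', p, hp, f, h₁, h₂⟩ := assoc_mpr (tgt_mul b) h
  obtain rfl := eq_of_unit_right ((by simpa using (U_snd (b ≫ F.tgt)).pull p)) h₁
  rw [← cancel_epi p]
  exact (Category.assoc _ _ _).symm.trans (eq_src (o := p ≫ b ≫ F.tgt) (by simpa using h₁))

lemma M.src_eq {a b c : T ⟶ F.carrier} (h : F.M a b c) : c ≫ F.src = b ≫ F.src := by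
  obtain ⟨T', p, hp, f, h₁, h₂⟩ := assoc_mpr (mul_src b) h
  obtain rfl := (h.pull p).unique h₁
  rw [← cancel_epi p]
  exact (Category.assoc _ _ _).symm.trans (eq_src (o := p ≫ b ≫ F.src) (by simpa using h₂))

lemma M.tgt_eq {a b c : T ⟶ F.carrier} (h : F.M a b c) : c ≫ F.tgt = a ≫ F.tgt := by
  obtain ⟨T', p, hp, f, h₁, h₂⟩ := assoc_mp (tgt_mul a) h
  obtain rfl := (h.pull p).unique h₁
  rw [← cancel_epi p]
  exact (Category.assoc _ _ _).symm.trans (eq_tgt (o := p ≫ a ≫ F.tgt) (by simpa using h₂))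

lemma M.assoc {a b c d e f : T ⟶ F.carrier} (h₁ : F.M a b e) (h₂ : F.M e c d) (h₃ : F.M b c f) :
    F.M a f d := by
  obtain ⟨T', p, hp, g, h₄, h₅⟩ := assoc_mp h₁ h₂
  obtain rfl := (h₃.pull p).unique h₄
  exact h₅.descend p

/-- The common identity `e` satisfies `a e = a` and `e b = b`. By the Frobenius law in the form
`mult_mult_iff`, such an `e` exists locally only if `a` and `b` have a product locally, and that
product is unique. -/
lemma exists_mul {a b : T ⟶ F.carrier} (h : a ≫ F.src = b ≫ F.tgt) : ∃ c, F.M a b c := by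
  refine IntRel.exists_holds_of_unique F.mult (prod.lift a b) ?_ fun W t c c' h₁ h₂ => ?_
  · obtain ⟨T', p, hp, e, h₁, h₂⟩ := (mult_mult_iff a b a b).1
      ⟨T, 𝟙 T, inferInstance, a ≫ F.src ≫ F.unit.snd, by simpa using mul_src a, by
        rw [reassoc_of% h]
        simpa using tgt_mul b⟩
    exact ⟨T', p, hp, e, by simpa [M] using h₁⟩
  · rw [prod.comp_lift] at h₁ h₂
    exact M.unique h₁ h₂


lemma M.inv_unique {a e e' : T ⟶ F.carrier} {o o' : T ⟶ (F.unit : C)}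
    (h₁ : F.M e a (o ≫ F.unit.snd)) (h₂ : F.M a e' (o' ≫ F.unit.snd))
    (h₃ : F.M (o ≫ F.unit.snd) e' e') : e = e' :=
  eq_of_unit_right (U_snd _) (h₁.assoc h₃ h₂)

lemma idn_src : F.unit.snd ≫ F.src = 𝟙 _ := by
  have h : F.U F.unit.snd := by simpa using U_snd (𝟙 (F.unit : C))
  exact eq_src (by simpa using unit_idem h)

lemma idn_tgt : F.unit.snd ≫ F.tgt = 𝟙 _ := by
  have h : F.U F.unit.snd := by simpa using U_snd (𝟙 (F.unit : C))
  exact eq_tgt (by simpa using unit_idem h)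

-- The Frobenius law, applied to the factorizations of the generic arrow through its target and
-- source identities, yields a two-sided inverse on a cover. Left inverses equal right inverses, so
-- it descends.
variable (F) in
lemma exists_inv : ∃ i : F.carrier ⟶ F.carrier,
    F.M i (𝟙 _) (F.src ≫ F.unit.snd) ∧ F.M (𝟙 _) i (F.tgt ≫ F.unit.snd) := by
  obtain ⟨T, p, hp, e, h₁, h₂⟩ := shift_left F.tgt_spec F.src_spec
  obtain ⟨i, rfl⟩ := exists_descend p e fun W s t hst => by
    have h₃ := h₂.pull s
    have h₄ := h₁.pull t
    have h₅ := h₂.pull t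
    have h₆ := tgt_mul (t ≫ e)
    rw [← Category.assoc, ← h₅.tgt_eq] at h₆
    simp only [Category.comp_id, ← Category.assoc] at h₃ h₄ h₅ h₆
    rw [Category.assoc ((t ≫ p) ≫ F.src), idn_tgt, Category.comp_id] at h₆
    rw [hst] at h₃
    exact h₃.inv_unique h₄ h₆
  exact ⟨i, h₂.descend p, h₁.descend p⟩

variable (F) in
/-- The groupoid of a special dagger Frobenius structure. -/
def presentation : GroupoidPresentation C where
  obj := (F.unit : C)
  arr := F.carrier
  src := F.src
  tgt := F.tgt
  idn := F.unit.snd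
  inv := F.exists_inv.choose
  Mul _ a b c := F.M a b c
  idn_src := idn_src
  idn_tgt := idn_tgt
  mul_pull _ _ p _ _ _ h := h.pull p
  mul_comp _ _ _ _ h := h.comp_eq
  mul_src _ _ _ _ h := h.src_eq
  mul_tgt _ _ _ _ h := h.tgt_eq
  mul_unique _ _ _ _ _ h h' := h.unique h'
  exists_mul _ _ _ h := exists_mul h
  idn_mul := F.tgt_spec
  mul_idn := F.src_spec
  mul_assoc _ _ _ _ _ _ _ h₁ h₂ h₃ := h₁.assoc h₂ h₃
  inv_mul := F.exists_inv.choose_spec.1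
  mul_inv := F.exists_inv.choose_spec.2

lemma eq_of_heq {F F' : FrobeniusStructure C} (h : F.carrier = F'.carrier)
    (hm : HEq F.mult F'.mult) (hu : HEq F.unit F'.unit) : F = F' := by
  cases F
  cases F'
  dsimp at h
  subst h
  simp_all

variable (F) in
/-- The multiplication and unit of a special dagger Frobenius structure are the composition and
identities of its groupoid. -/
lemma toFrobenius_toGroupoid : F.presentation.toGroupoid.toFrobenius = F := by
  refine eq_of_heq rfl (heq_of_eq ?_) (heq_of_eq ?_)
  · refine ext_holds fun T x c => ?_
    obtain ⟨a, b, rfl⟩ : ∃ a b, x = prod.lift a b := ⟨_, _, (lift_eta x).symm⟩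
    exact (multRel_holds _ _ _).trans (F.presentation.toGroupoid_mul a b c)
  · refine ext_holds fun T t x => ?_
    refine (unitRel_holds _ _).trans ⟨?_, fun h => ?_⟩
    · rintro ⟨o, rfl⟩
      rw [Subsingleton.elim t (terminal.from T)]
      exact U_snd o
    · rw [Subsingleton.elim t (terminal.from T)] at h
      exact ⟨U.lift h, U.lift_snd h⟩

end FrobeniusStructure

/-- In a positively regular category, groupoids and relations respecting inverses are equivalent
to special dagger Frobenius structures and completely positive relations. -/
lemma inverseRelToCP_isEquivalence
    (hE : ∀ ⦃G H : InternalGroupoid C⦄ (R : IntRel G.arr H.arr),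
      RespectsInverses G H R → IsCompletelyPositive G.toFrobenius H.toFrobenius R) :
    (inverseRelToCP C hE).IsEquivalence where
  faithful := ⟨fun {_ _ _ _} h => InverseRelHom.ext (congrArg CPHom.rel h)⟩
  full := ⟨fun R => ⟨⟨R.rel, R.isCompletelyPositive.respectsInverses⟩, rfl⟩⟩
  essSurj := ⟨fun F =>
    ⟨⟨F.presentation.toGroupoid⟩, ⟨eqToIso F.toFrobenius_toGroupoid⟩⟩⟩

end RegularCategory

/-! ### Limits of groupoids -/

section RegularCategory

variable {C : Type u} [Category.{v} C] [Regular C]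

open IntRel

namespace InternalGroupoid

variable {G H : InternalGroupoid C}

lemma comp_onArr {G H K : InternalGroupoid C} (f : G ⟶ H) (g : H ⟶ K) :
    InternalFunctor.onArr (f ≫ g) = InternalFunctor.onArr f ≫ InternalFunctor.onArr g :=
  rfl

lemma Mul.map {T : C} {a b c : T ⟶ G.arr} (h : G.Mul a b c) (f : G ⟶ H) :
    H.Mul (a ≫ InternalFunctor.onArr f) (b ≫ InternalFunctor.onArr f)
      (c ≫ InternalFunctor.onArr f) := by
  obtain ⟨h, rfl⟩ := h
  refine ⟨by simp [InternalFunctor.onArr_src f, InternalFunctor.onArr_tgt f, reassoc_of% h], ?_⟩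
  refine Eq.trans ?_ (Category.assoc (pullback.lift a b h) _ _).symm
  rw [InternalFunctor.m_onArr f]
  refine Eq.trans ?_ (Category.assoc (pullback.lift a b h) _ _)
  congr 1
  ext <;> simp

lemma idn_map (f : G ⟶ H) {T : C} (o : T ⟶ G.obj) :
    (o ≫ G.idn) ≫ InternalFunctor.onArr f = (o ≫ InternalFunctor.onObj f) ≫ H.idn := by
  rw [Category.assoc, InternalFunctor.idn_onArr f, Category.assoc]

lemma inv_map (f : G ⟶ H) {T : C} (a : T ⟶ G.arr) :
    (a ≫ G.inv) ≫ InternalFunctor.onArr f = (a ≫ InternalFunctor.onArr f) ≫ H.inv := by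
  have h := (mul_inv a).map f
  rw [← Category.assoc, idn_map] at h
  exact h.eq_inv

lemma mul_fst_snd (G : InternalGroupoid C) :
    G.Mul (pullback.fst G.src G.tgt) (pullback.snd G.src G.tgt) G.m := by
  refine ⟨pullback.condition, ?_⟩
  rw [pullback.lift_fst_snd, Category.id_comp]

-- Objects are recovered as sources of their identities, so the action on arrows determines a
-- functor. This reduces universal properties in `Gpd(C)` to statements about arrows.
@[ext]
lemma hom_ext {f g : G ⟶ H} (h : InternalFunctor.onArr f = InternalFunctor.onArr g) : f = g := by
  have key (k : G ⟶ H) : InternalFunctor.onObj k = G.idn ≫ InternalFunctor.onArr k ≫ H.src := by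
    rw [← Category.assoc, InternalFunctor.idn_onArr k, Category.assoc, H.idn_src, Category.comp_id]
  exact InternalFunctor.ext (by rw [key f, key g, h]) h

/-- A morphism of arrows that preserves composition is a functor between groupoids. -/
def homOfMul (φ : G.arr ⟶ H.arr) (h : ∀ ⦃T : C⦄ (a b c : T ⟶ G.arr), G.Mul a b c →
    H.Mul (a ≫ φ) (b ≫ φ) (c ≫ φ)) : G ⟶ H :=
  -- The image of an identity is idempotent, and an idempotent of a groupoid is an identity by
  -- cancellation; so preservation of identities comes for free.
  have hi : H.Mul (G.idn ≫ φ) (G.idn ≫ φ) (G.idn ≫ φ) := by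
    have k := idn_mul G.idn
    rw [reassoc_of% G.idn_tgt] at k
    exact h _ _ _ k
  { onObj := G.idn ≫ φ ≫ H.src
    onArr := φ
    onArr_src := by
      have k := h _ _ _ (mul_idn (𝟙 G.arr))
      simpa using k.src_eq
    onArr_tgt := by
      have k := h _ _ _ (idn_mul (𝟙 G.arr))
      have k' := k.tgt_eq
      simp only [Category.id_comp, Category.assoc] at k'
      rw [k', ← Category.assoc G.idn, ← Category.assoc G.idn, hi.comp_eq]
    idn_onArr := by
      simpa using hi.right_unique (mul_idn _)
    m_onArr := by
      obtain ⟨k₁, k₂⟩ := h _ _ _ G.mul_fst_snd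
      exact k₂.symm }

end InternalGroupoid

open InternalGroupoid

variable (C) in
/-- The functor `Gpd(C) ⥤ C` sending a groupoid to its object of objects. -/
def groupoidObjects : InternalGroupoid C ⥤ C where
  obj G := G.obj
  map f := InternalFunctor.onObj f

section Limits

variable {J : Type u'} [Category.{v'} J] [HasLimitsOfShape J C] (F : J ⥤ InternalGroupoid C)

/-- The projections from the limit of the objects of morphisms. -/
def limitArrπ (j : J) : limit (F ⋙ groupoidArrows C) ⟶ (F.obj j).arr :=
  limit.π (F ⋙ groupoidArrows C) j

/-- The projections from the limit of the objects of objects. -/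
def limitObjπ (j : J) : limit (F ⋙ groupoidObjects C) ⟶ (F.obj j).obj :=
  limit.π (F ⋙ groupoidObjects C) j

variable {F}

lemma limitArr_hom_ext {T : C} {x y : T ⟶ limit (F ⋙ groupoidArrows C)}
    (h : ∀ j, x ≫ limitArrπ F j = y ≫ limitArrπ F j) : x = y :=
  limit.hom_ext h

lemma limitObj_hom_ext {T : C} {x y : T ⟶ limit (F ⋙ groupoidObjects C)}
    (h : ∀ j, x ≫ limitObjπ F j = y ≫ limitObjπ F j) : x = y :=
  limit.hom_ext h

lemma limitArrπ_naturality {j j' : J} (f : j ⟶ j') :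
    limitArrπ F j ≫ InternalFunctor.onArr (F.map f) = limitArrπ F j' :=
  limit.w (F ⋙ groupoidArrows C) f

lemma limitObjπ_naturality {j j' : J} (f : j ⟶ j') :
    limitObjπ F j ≫ InternalFunctor.onObj (F.map f) = limitObjπ F j' :=
  limit.w (F ⋙ groupoidObjects C) f

/-- Lifts to the limit of the objects of morphisms. -/
def limitArrLift {T : C} (x : ∀ j, T ⟶ (F.obj j).arr)
    (h : ∀ ⦃j j'⦄ (f : j ⟶ j'), x j ≫ InternalFunctor.onArr (F.map f) = x j') :
    T ⟶ limit (F ⋙ groupoidArrows C) :=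
  limit.lift (F ⋙ groupoidArrows C)
    { pt := T, π := { app := x, naturality := fun _ _ f => (Category.id_comp _).trans (h f).symm } }

@[simp]
lemma limitArrLift_π {T : C} (x : ∀ j, T ⟶ (F.obj j).arr) (h) (j : J) :
    limitArrLift x h ≫ limitArrπ F j = x j :=
  limit.lift_π _ _

@[simp]
lemma limitArrLift_π_assoc {T X : C} (x : ∀ j, T ⟶ (F.obj j).arr) (h) (j : J)
    (f : (F.obj j).arr ⟶ X) : limitArrLift x h ≫ limitArrπ F j ≫ f = x j ≫ f := by
  rw [← Category.assoc, limitArrLift_π]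

/-- Lifts to the limit of the objects of objects. -/
def limitObjLift {T : C} (x : ∀ j, T ⟶ (F.obj j).obj)
    (h : ∀ ⦃j j'⦄ (f : j ⟶ j'), x j ≫ InternalFunctor.onObj (F.map f) = x j') :
    T ⟶ limit (F ⋙ groupoidObjects C) :=
  limit.lift (F ⋙ groupoidObjects C)
    { pt := T, π := { app := x, naturality := fun _ _ f => (Category.id_comp _).trans (h f).symm } }

@[simp]
lemma limitObjLift_π {T : C} (x : ∀ j, T ⟶ (F.obj j).obj) (h) (j : J) :
    limitObjLift x h ≫ limitObjπ F j = x j :=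
  limit.lift_π _ _

@[simp]
lemma limitObjLift_π_assoc {T X : C} (x : ∀ j, T ⟶ (F.obj j).obj) (h) (j : J)
    (f : (F.obj j).obj ⟶ X) : limitObjLift x h ≫ limitObjπ F j ≫ f = x j ≫ f := by
  rw [← Category.assoc, limitObjLift_π]

variable (F)

/-- The limit of a diagram of groupoids, computed levelwise. -/
def limitPresentation : GroupoidPresentation C where
  obj := limit (F ⋙ groupoidObjects C)
  arr := limit (F ⋙ groupoidArrows C)
  src := limitObjLift (fun j => limitArrπ F j ≫ (F.obj j).src) fun j j' f => by
    rw [Category.assoc, ← InternalFunctor.onArr_src (F.map f), ← Category.assoc,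
      limitArrπ_naturality]
  tgt := limitObjLift (fun j => limitArrπ F j ≫ (F.obj j).tgt) fun j j' f => by
    rw [Category.assoc, ← InternalFunctor.onArr_tgt (F.map f), ← Category.assoc,
      limitArrπ_naturality]
  idn := limitArrLift (fun j => limitObjπ F j ≫ (F.obj j).idn) fun j j' f => by
    rw [idn_map, limitObjπ_naturality]
  inv := limitArrLift (fun j => limitArrπ F j ≫ (F.obj j).inv) fun j j' f => by
    rw [inv_map, limitArrπ_naturality]
  Mul _ a b c := ∀ j, (F.obj j).Mul (a ≫ limitArrπ F j) (b ≫ limitArrπ F j) (c ≫ limitArrπ F j)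
  idn_src := limitObj_hom_ext fun j => by
    simp [(F.obj j).idn_src]
  idn_tgt := limitObj_hom_ext fun j => by
    simp [(F.obj j).idn_tgt]
  mul_pull _ _ p _ _ _ h j := by simpa using (h j).pull p
  mul_comp _ _ _ _ h := limitObj_hom_ext fun j => by simpa using (h j).comp_eq
  mul_src _ _ _ _ h := limitObj_hom_ext fun j => by simpa using (h j).src_eq
  mul_tgt _ _ _ _ h := limitObj_hom_ext fun j => by simpa using (h j).tgt_eq
  mul_unique _ _ _ _ _ h h' := limitArr_hom_ext fun j => (h j).unique (h' j)
  exists_mul T a b h := by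
    have h' (j : J) : (a ≫ limitArrπ F j) ≫ (F.obj j).src = (b ≫ limitArrπ F j) ≫ (F.obj j).tgt := by
      simpa using congrArg (· ≫ limitObjπ F j) h
    choose c hc using fun j => InternalGroupoid.exists_mul (h' j)
    refine ⟨limitArrLift c fun j j' f => ?_, fun j => by simpa using hc j⟩
    have k := (hc j).map (F.map f)
    rw [Category.assoc, Category.assoc, limitArrπ_naturality] at k
    exact k.unique (hc j')
  idn_mul j := by simpa using InternalGroupoid.idn_mul (limitArrπ F j)
  mul_idn j := by simpa using InternalGroupoid.mul_idn (limitArrπ F j)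
  mul_assoc _ _ _ _ _ _ _ h₁ h₂ h₃ j := (h₁ j).assoc (h₂ j) (h₃ j)
  inv_mul j := by simpa using InternalGroupoid.inv_mul (limitArrπ F j)
  mul_inv j := by simpa using InternalGroupoid.mul_inv (limitArrπ F j)

/-- The levelwise limit cone of a diagram of groupoids. -/
def groupoidLimitCone : Cone F where
  pt := (limitPresentation F).toGroupoid
  π :=
    { app := fun j => homOfMul (limitArrπ F j) fun _ a b c h =>
        ((limitPresentation F).toGroupoid_mul a b c).1 h j
      naturality := fun _ _ f => InternalGroupoid.hom_ext
        ((Category.id_comp _).trans (limitArrπ_naturality f).symm) }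

variable {F} in
/-- Lifts to the limit of a diagram of groupoids. -/
def limitGroupoidLift {G : InternalGroupoid C} (f : ∀ j, G ⟶ F.obj j)
    (w : ∀ ⦃j j'⦄ (k : j ⟶ j'), f j ≫ F.map k = f j') :
    G ⟶ (limitPresentation F).toGroupoid :=
  homOfMul (limitArrLift (fun j => InternalFunctor.onArr (f j)) fun _ _ k => by
    rw [← comp_onArr, w]) fun T a b c h => ((limitPresentation F).toGroupoid_mul _ _ _).2 fun j => by
      have e (x : T ⟶ G.arr) : (x ≫ limitArrLift (fun j => InternalFunctor.onArr (f j))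
          fun _ _ k => by rw [← comp_onArr, w]) ≫ limitArrπ F j =
            x ≫ InternalFunctor.onArr (f j) := by simp
      have k := h.map (f j)
      rw [← e a, ← e b, ← e c] at k
      exact k

variable {F} in
lemma limitGroupoidLift_π {G : InternalGroupoid C} (f : ∀ j, G ⟶ F.obj j) (w) (j : J) :
    InternalFunctor.onArr (limitGroupoidLift f w) ≫ limitArrπ F j = InternalFunctor.onArr (f j) :=
  limitArrLift_π (fun j => InternalFunctor.onArr (f j)) (fun _ _ k => by rw [← comp_onArr, w]) j

/-- The levelwise limit cone of a diagram of groupoids is a limit cone. -/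
def groupoidLimitConeIsLimit : IsLimit (groupoidLimitCone F) where
  lift s := limitGroupoidLift (fun j => s.π.app j) fun _ _ f => s.w f
  fac s j := InternalGroupoid.hom_ext (limitGroupoidLift_π (fun j => s.π.app j) _ j)
  uniq s _ h := InternalGroupoid.hom_ext <| limitArr_hom_ext fun j =>
    (congrArg InternalFunctor.onArr (h j)).trans
      (limitGroupoidLift_π (fun j => s.π.app j) (fun _ _ f => s.w f) j).symm

scoped instance : HasLimitsOfShape J (InternalGroupoid C) :=
  ⟨fun F => ⟨⟨⟨_, groupoidLimitConeIsLimit F⟩⟩⟩⟩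

-- The levelwise limit cone is mapped to the chosen limit cone in `C`. As a consequence, kernel
-- pairs, pullbacks and monomorphisms of groupoids can be inspected on arrows.
scoped instance : PreservesLimitsOfShape J (groupoidArrows C) :=
  ⟨fun {F} => preservesLimit_of_preserves_limit_cone (groupoidLimitConeIsLimit F)
    ((limit.isLimit (F ⋙ groupoidArrows C)).ofIsoLimit (Cone.ext (Iso.refl _) fun _ =>
      (Category.id_comp _).symm))⟩

end Limits

scoped instance : HasFiniteLimits (InternalGroupoid C) := ⟨fun _ _ _ => inferInstance⟩

scoped instance : PreservesFiniteLimits (groupoidArrows C) := ⟨fun _ _ _ => inferInstance⟩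

end RegularCategory

/-! ### Groupoids in Mal'cev categories -/

section RegularCategory

variable {C : Type u} [Category.{v} C] [Regular C]

open IntRel InternalGroupoid

variable {G H : InternalGroupoid C}

/-- A span covers its image. -/
lemma isRegularEpi_lift_ofSpan {X A B : C} (f : X ⟶ A) (g : X ⟶ B) (h : (ofSpan f g).Holds f g) :
    IsRegularEpi (lift f g h) := by
  have e : lift f g h = factorThruImageSubobject (prod.lift f g) :=
    (cancel_mono (imageSubobject (prod.lift f g)).arrow).1
      ((lift_arrow f g h).trans (imageSubobject_arrow_comp _).symm)
  have hse : StrongEpi (factorThruImageSubobject (prod.lift f g)) := by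
    unfold factorThruImageSubobject
    infer_instance
  have hre : IsRegularEpi (factorThruImageSubobject (prod.lift f g)) := inferInstance
  exact e ▸ hre

/-- A relation between groupoids is multiplicative if it is closed under composition. -/
def IsMultiplicative (R : IntRel G.arr H.arr) : Prop :=
  ∀ ⦃T : C⦄ ⦃a a' a'' : T ⟶ G.arr⦄ ⦃b b' b'' : T ⟶ H.arr⦄, G.Mul a a' a'' → H.Mul b b' b'' →
    R.Holds a b → R.Holds a' b' → R.Holds a'' b''

lemma inv_src_idn {T : C} (a : T ⟶ G.arr) : (a ≫ G.inv) ≫ G.src ≫ G.idn = a ≫ G.tgt ≫ G.idn := by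
  rw [Category.assoc, ← Category.assoc G.inv, G.inv_src]

lemma RespectsInverses.tgt {R : IntRel G.arr H.arr} (hR : RespectsInverses G H R) {T : C}
    {a : T ⟶ G.arr} {b : T ⟶ H.arr} (h : R.Holds a b) :
    R.Holds (a ≫ G.tgt ≫ G.idn) (b ≫ H.tgt ≫ H.idn) := by
  simpa only [inv_src_idn] using (hR _ _ (hR _ _ h).1).2

/-- In a Mal'cev category, relations between groupoids that respect inverses are closed under
composition. -/
lemma RespectsInverses.isMultiplicative (hC : IsMalcev C) {R : IntRel G.arr H.arr}
    (hR : RespectsInverses G H R) : IsMultiplicative R := by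
  intro T a a' a'' b b' b'' hab hab' h h'
  have e : a ≫ G.src ≫ G.idn = a' ≫ G.tgt ≫ G.idn := by
    rw [← Category.assoc, hab.comp_eq, Category.assoc]
  -- Three corners of a difunctionality square for the Choi matrix: `(a', 1) ~ (1, b')`, `(1, b') ~
  -- (1, b')` and `(1, b') ~ (a⁻¹, b'')`. The fourth corner `(a', 1) ~ (a⁻¹, b'')` says `R(aa',
  -- b'')`.
  have h₁ := choi_multRel_holds_of (idn_mul a') h' (mul_idn b')
  have h₂ : (choi G.multRel H.multRel R).Holds (prod.lift (a' ≫ G.tgt ≫ G.idn) b')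
      (prod.lift (a' ≫ G.tgt ≫ G.idn) b') := by
    refine choi_multRel_holds_of ?_ (hR.tgt h') (idn_mul b')
    simpa [reassoc_of% G.idn_tgt] using idn_mul (a' ≫ G.tgt ≫ G.idn)
  have h₃ : (choi G.multRel H.multRel R).Holds (prod.lift (a' ≫ G.tgt ≫ G.idn) b')
      (prod.lift (a ≫ G.inv) b'') :=
    choi_multRel_holds_of (e ▸ inv_mul a) h hab'
  refine holds_of_choi_multRel_holds hab.inv_mul_cancel ?_ (hC.difunctional _ h₁ h₂ h₃)
  have k := mul_idn b''
  rwa [← Category.assoc, hab'.src_eq, Category.assoc] at k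

/-- The image of a span of functors between groupoids respects inverses. -/
lemma respectsInverses_ofSpan {K : InternalGroupoid C} (f : K ⟶ G) (g : K ⟶ H) :
    RespectsInverses G H (ofSpan (InternalFunctor.onArr f) (InternalFunctor.onArr g)) := by
  intro T a b h
  obtain ⟨T', p, hp, x, h₁, h₂⟩ := (ofSpan_holds _ _ _ _).1 h
  constructor
  · refine (ofSpan_holds _ _ _ _).2 ⟨T', p, hp, x ≫ K.inv, ?_, ?_⟩
    · rw [inv_map, h₁, Category.assoc]
    · rw [inv_map, h₂, Category.assoc]
  · refine (ofSpan_holds _ _ _ _).2 ⟨T', p, hp, (x ≫ K.src) ≫ K.idn, ?_, ?_⟩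
    · rw [idn_map, Category.assoc x, ← InternalFunctor.onArr_src f, ← Category.assoc x, h₁]
      simp
    · rw [idn_map, Category.assoc x, ← InternalFunctor.onArr_src g, ← Category.assoc x, h₂]
      simp

/-- In a Mal'cev category, a morphism of arrows between groupoids is a functor if its graph
respects inverses. -/
lemma IsMalcev.mul_map_of_graph (hC : IsMalcev C) {φ : G.arr ⟶ H.arr}
    (hφ : RespectsInverses G H (graph φ)) {T : C} {a b c : T ⟶ G.arr} (h : G.Mul a b c) :
    H.Mul (a ≫ φ) (b ≫ φ) (c ≫ φ) := by
  have hg {S : C} (x : S ⟶ G.arr) : (graph φ).Holds x (x ≫ φ) := (graph_holds _ _ _).2 rfl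
  -- That the graph respects inverses means that `φ` preserves source and target identities. So the
  -- images of composable arrows are composable, and closure of the graph under composition
  -- identifies the composite.
  have h₁ := (graph_holds _ _ _).1 (hφ _ _ (hg a)).2
  have h₂ := (graph_holds _ _ _).1 (hφ.tgt (hg b))
  have e : a ≫ G.src ≫ G.idn = b ≫ G.tgt ≫ G.idn := by
    rw [← Category.assoc, h.comp_eq, Category.assoc]
  rw [e, h₂] at h₁
  have h₃ := congrArg (· ≫ H.src) h₁
  simp only [Category.assoc, H.idn_src, Category.comp_id] at h₃
  obtain ⟨d, hd⟩ := exists_mul (a := a ≫ φ) (b := b ≫ φ) (by simpa using h₃.symm)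
  rwa [(graph_holds _ _ _).1 (hφ.isMultiplicative hC h hd (hg a) (hg b))]

/-- The groupoid of elements of a multiplicative relation that respects inverses. -/
def relationPresentation (R : IntRel G.arr H.arr) (hR : RespectsInverses G H R)
    (hm : IsMultiplicative R) : GroupoidPresentation C where
  obj := (inverseImage G.idn H.idn R : C)
  arr := (R : C)
  src := lift (R.fst ≫ G.src) (R.snd ≫ H.src)
    ((inverseImage_holds _ _ _ _).2 (by simpa using (hR _ _ R.holds_fst_snd).2))
  tgt := lift (R.fst ≫ G.tgt) (R.snd ≫ H.tgt)
    ((inverseImage_holds _ _ _ _).2 (by simpa using hR.tgt R.holds_fst_snd))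
  idn := lift ((inverseImage G.idn H.idn R).fst ≫ G.idn) ((inverseImage G.idn H.idn R).snd ≫ H.idn)
    ((inverseImage_holds _ _ _ _).1 (holds_fst_snd _))
  inv := lift (R.fst ≫ G.inv) (R.snd ≫ H.inv) (hR _ _ R.holds_fst_snd).1
  Mul _ a b c := G.Mul (a ≫ R.fst) (b ≫ R.fst) (c ≫ R.fst) ∧
    H.Mul (a ≫ R.snd) (b ≫ R.snd) (c ≫ R.snd)
  idn_src := IntRel.hom_ext (by simp [G.idn_src]) (by simp [H.idn_src])
  idn_tgt := IntRel.hom_ext (by simp [G.idn_tgt]) (by simp [H.idn_tgt])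
  mul_pull _ _ p _ _ _ h := by simpa using ⟨h.1.pull p, h.2.pull p⟩
  mul_comp _ _ _ _ h :=
    IntRel.hom_ext (by simpa using h.1.comp_eq) (by simpa using h.2.comp_eq)
  mul_src _ _ _ _ h := IntRel.hom_ext (by simpa using h.1.src_eq) (by simpa using h.2.src_eq)
  mul_tgt _ _ _ _ h := IntRel.hom_ext (by simpa using h.1.tgt_eq) (by simpa using h.2.tgt_eq)
  mul_unique _ _ _ _ _ h h' := IntRel.hom_ext (h.1.unique h'.1) (h.2.unique h'.2)
  exists_mul T a b h := by
    obtain ⟨c, hc⟩ := InternalGroupoid.exists_mul (a := a ≫ R.fst) (b := b ≫ R.fst)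
      (by simpa using congrArg (· ≫ IntRel.fst _) h)
    obtain ⟨d, hd⟩ := InternalGroupoid.exists_mul (a := a ≫ R.snd) (b := b ≫ R.snd)
      (by simpa using congrArg (· ≫ IntRel.snd _) h)
    exact ⟨lift c d (hm hc hd (R.holds_comp a) (R.holds_comp b)), by simpa using ⟨hc, hd⟩⟩
  idn_mul := by simpa using ⟨InternalGroupoid.idn_mul R.fst, InternalGroupoid.idn_mul R.snd⟩
  mul_idn := by simpa using ⟨InternalGroupoid.mul_idn R.fst, InternalGroupoid.mul_idn R.snd⟩
  mul_assoc _ _ _ _ _ _ _ h₁ h₂ h₃ := ⟨h₁.1.assoc h₂.1 h₃.1, h₁.2.assoc h₂.2 h₃.2⟩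
  inv_mul := by simpa using ⟨InternalGroupoid.inv_mul R.fst, InternalGroupoid.inv_mul R.snd⟩
  mul_inv := by simpa using ⟨InternalGroupoid.mul_inv R.fst, InternalGroupoid.mul_inv R.snd⟩

section

variable (R : IntRel G.arr H.arr) (hR : RespectsInverses G H R) (hm : IsMultiplicative R)

/-- The first projection of the groupoid of elements of a relation. -/
def relationFst : (relationPresentation R hR hm).toGroupoid ⟶ G :=
  homOfMul R.fst fun _ _ _ _ h => (((relationPresentation R hR hm).toGroupoid_mul _ _ _).1 h).1

/-- The second projection of the groupoid of elements of a relation. -/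
def relationSnd : (relationPresentation R hR hm).toGroupoid ⟶ H :=
  homOfMul R.snd fun _ _ _ _ h => (((relationPresentation R hR hm).toGroupoid_mul _ _ _).1 h).2

variable {R} in
/-- A pair of functors with related values lifts to the groupoid of elements of a relation. -/
def relationLift {K : InternalGroupoid C} (f : K ⟶ G) (g : K ⟶ H)
    (h : R.Holds (InternalFunctor.onArr f) (InternalFunctor.onArr g)) :
    K ⟶ (relationPresentation R hR hm).toGroupoid :=
  homOfMul (lift _ _ h) fun T a b c k => ((relationPresentation R hR hm).toGroupoid_mul _ _ _).2 (by
    have e₁ (x : T ⟶ K.arr) : (x ≫ lift _ _ h) ≫ R.fst = x ≫ InternalFunctor.onArr f := by simp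
    have e₂ (x : T ⟶ K.arr) : (x ≫ lift _ _ h) ≫ R.snd = x ≫ InternalFunctor.onArr g := by simp
    have k₁ := k.map f
    have k₂ := k.map g
    rw [← e₁, ← e₁, ← e₁] at k₁
    rw [← e₂, ← e₂, ← e₂] at k₂
    exact ⟨k₁, k₂⟩)

end

lemma mono_of_mono_onArr (f : G ⟶ H) [Mono (InternalFunctor.onArr f)] : Mono f :=
  ⟨fun _ _ h => InternalGroupoid.hom_ext <| (cancel_mono (InternalFunctor.onArr f)).1 <|
    congrArg InternalFunctor.onArr h⟩

/-- In a Mal'cev category, functors between groupoids factor as functors that are covers on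
arrows, followed by monomorphisms. -/
lemma IsMalcev.exists_factorization (hC : IsMalcev C) (f : G ⟶ H) :
    ∃ (K : InternalGroupoid C) (q : G ⟶ K) (m : K ⟶ H), IsRegularEpi (InternalFunctor.onArr q) ∧
      Mono m ∧ q ≫ m = f := by
  let φ := InternalFunctor.onArr f
  -- The image of `f` is encoded as the relation spanned by `(f, f)`, so that closure under
  -- composition applies to it. It lies on the diagonal, hence its first projection is a
  -- monomorphism.
  have hR := respectsInverses_ofSpan f f
  have hm := hR.isMultiplicative hC
  have hφ : (ofSpan φ φ).Holds φ φ := by simpa using ofSpan_holds_self φ φ (𝟙 _)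
  have e : (ofSpan φ φ).fst = (ofSpan φ φ).snd := by
    obtain ⟨T', p, hp, x, h₁, h₂⟩ := (ofSpan_holds φ φ _ _).1 (ofSpan φ φ).holds_fst_snd
    exact (cancel_epi p).1 (h₁.symm.trans h₂)
  refine ⟨_, relationLift hR hm f f hφ, relationFst _ hR hm, ?_, ?_, ?_⟩
  · exact isRegularEpi_lift_ofSpan φ φ hφ
  · have : Mono (ofSpan φ φ).fst := ⟨fun x y h => IntRel.hom_ext h (by rwa [← e])⟩
    exact @mono_of_mono_onArr _ _ _ _ _ (relationFst _ hR hm) this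
  · exact InternalGroupoid.hom_ext (lift_fst φ φ hφ)

lemma isKernelPair_onArr {K : InternalGroupoid C} {f : G ⟶ H} {p₁ p₂ : K ⟶ G}
    (h : IsKernelPair f p₁ p₂) : IsKernelPair (InternalFunctor.onArr f) (InternalFunctor.onArr p₁)
      (InternalFunctor.onArr p₂) :=
  IsPullback.map (groupoidArrows C) h

/-- In a Mal'cev category, functors between groupoids that are covers on arrows are regular
epimorphisms. -/
lemma IsMalcev.isRegularEpi_of_onArr (hC : IsMalcev C) (f : G ⟶ H)
    [IsRegularEpi (InternalFunctor.onArr f)] : IsRegularEpi f := by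
  have key {L : InternalGroupoid C} (h : G ⟶ L)
      (w : pullback.fst f f ≫ h = pullback.snd f f ≫ h) : ∃ k : H ⟶ L, f ≫ k = h := by
    -- The kernel pair of `f` is computed on arrows, so `h` descends to a morphism `φ` of arrows,
    -- not yet known to be a functor.
    have hk := isKernelPair_onArr (IsKernelPair.of_hasPullback f)
    obtain ⟨φ, hφ⟩ := exists_descend (InternalFunctor.onArr f) (InternalFunctor.onArr h)
      fun W s t hst => by
        have w' := congrArg (hk.lift s t hst ≫ InternalFunctor.onArr ·) w
        simpa [comp_onArr, ← Category.assoc] using w'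
    -- As the image of a span of functors, the graph of `φ` respects inverses; in a Mal'cev category
    -- this makes `φ` a functor.
    have e : graph φ = ofSpan (InternalFunctor.onArr f) (InternalFunctor.onArr h) := by
      refine ext_holds fun T a b => ?_
      rw [graph_holds, ofSpan_holds]
      constructor
      · rintro rfl
        exact ⟨_, pullback.fst a (InternalFunctor.onArr f), inferInstance, pullback.snd _ _,
          pullback.condition.symm, by rw [← hφ, ← Category.assoc, ← pullback.condition,
            Category.assoc]⟩
      · rintro ⟨T', p, hp, x, h₁, h₂⟩
        rw [← cancel_epi p, ← h₂, ← Category.assoc, ← h₁, Category.assoc, hφ]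
    have hφ' : RespectsInverses H L (graph φ) := by
      rw [e]
      exact respectsInverses_ofSpan f h
    exact ⟨homOfMul φ fun T a b c => hC.mul_map_of_graph hφ', InternalGroupoid.hom_ext hφ⟩
  refine ⟨⟨⟨_, pullback.fst f f, pullback.snd f f, pullback.condition, ?_⟩⟩⟩
  refine Cofork.IsColimit.mk _ (fun s => (key s.π s.condition).choose)
    (fun s => (key s.π s.condition).choose_spec) fun s m hm => ?_
  have hk := (key s.π s.condition).choose_spec
  refine InternalGroupoid.hom_ext ?_
  rw [← cancel_epi (InternalFunctor.onArr f)]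
  exact congrArg InternalFunctor.onArr (hm.trans hk.symm)

/-- In the factorization into a cover on arrows and a monomorphism, the monomorphism is also a
strong epimorphism, hence invertible. -/
lemma IsMalcev.isRegularEpi_onArr (hC : IsMalcev C) (f : G ⟶ H) [IsRegularEpi f] :
    IsRegularEpi (InternalFunctor.onArr f) := by
  obtain ⟨K, q, m, hq, hm, rfl⟩ := hC.exists_factorization f
  have hs : StrongEpi m := strongEpi_of_strongEpi q m
  have hi : IsIso m := isIso_of_mono_of_strongEpi m
  have hi' : IsIso (InternalFunctor.onArr m) := (groupoidArrows C).map_isIso m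
  rw [comp_onArr]
  infer_instance

/-- Regular epimorphisms are detected on arrows, so their stability is inherited from `C`. A kernel
pair of `f` is also one of the cover part of `f`, which is then its coequalizer. -/
lemma IsMalcev.regular_internalGroupoid (hC : IsMalcev C) : Regular (InternalGroupoid C) where
  hasCoequalizer_of_isKernelPair {X Y Z f g₁ g₂} h := by
    obtain ⟨K, q, m, hq, hm, rfl⟩ := hC.exists_factorization f
    have hq' := hC.isRegularEpi_of_onArr q
    have h' : IsKernelPair q g₁ g₂ := IsKernelPair.cancel_right_of_mono h
    exact ⟨⟨⟨_, h'.toCoequalizer'⟩⟩⟩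
  regularEpiIsStableUnderBaseChange :=
    { of_isPullback := fun {_ _ _ _ f g f' g'} h hg => by
        have hg' : IsRegularEpi g := hg
        have h₁ := hC.isRegularEpi_onArr g
        have h₂ : IsRegularEpi (InternalFunctor.onArr g') :=
          Regular.regularEpiIsStableUnderBaseChange.of_isPullback (h.map (groupoidArrows C)) h₁
        exact hC.isRegularEpi_of_onArr g' }

end RegularCategory

/-! ### Functors acting on relations -/

section

variable {C : Type u} [Category.{v} C] [Regular C]

open IntRel

lemma IntRel.ofSpan_comp {X Y A B : C} (e : X ⟶ Y) [IsRegularEpi e] (f : Y ⟶ A) (g : Y ⟶ B) :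
    ofSpan (e ≫ f) (e ≫ g) = ofSpan f g := by
  refine ext_holds fun T a b => ?_
  rw [ofSpan_holds, ofSpan_holds]
  constructor
  · rintro ⟨T', p, hp, x, h₁, h₂⟩
    exact ⟨T', p, hp, x ≫ e, by simpa using h₁, by simpa using h₂⟩
  · rintro ⟨T', p, hp, x, h₁, h₂⟩
    refine ⟨_, pullback.fst x e ≫ p, inferInstance, pullback.snd x e, ?_, ?_⟩
    · rw [← Category.assoc, ← pullback.condition, Category.assoc, h₁, Category.assoc]
    · rw [← Category.assoc, ← pullback.condition, Category.assoc, h₂, Category.assoc]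

lemma IntRel.comp_ofSpan {X Y P A B D : C} {f : X ⟶ A} {g : X ⟶ B} {h : Y ⟶ B} {k : Y ⟶ D}
    {p : P ⟶ X} {q : P ⟶ Y} (hP : IsPullback p q g h) :
    comp (ofSpan f g) (ofSpan h k) = ofSpan (p ≫ f) (q ≫ k) := by
  refine ext_holds fun T a d => ?_
  rw [comp_holds, ofSpan_holds]
  constructor
  · rintro ⟨T₁, r, hr, b, h₁, h₂⟩
    obtain ⟨T₂, s, hs, x, h₃, h₄⟩ := (ofSpan_holds _ _ _ _).1 h₁
    obtain ⟨T₃, t, ht, y, h₅, h₆⟩ := (ofSpan_holds _ _ _ _).1 (h₂.pull s)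
    refine ⟨T₃, t ≫ s ≫ r, inferInstance, hP.lift (t ≫ x) y ?_, ?_, ?_⟩
    · rw [Category.assoc, h₄, h₅]
    · rw [hP.lift_fst_assoc, Category.assoc, h₃]
      simp
    · rw [hP.lift_snd_assoc, h₆]
      simp
  · rintro ⟨T', r, hr, x, h₁, h₂⟩
    refine ⟨T', r, hr, x ≫ p ≫ g, ?_, ?_⟩
    · rw [← h₁, ← Category.assoc, ← Category.assoc]
      exact ofSpan_holds_self f g (x ≫ p)
    · rw [← h₂, hP.w, ← Category.assoc, ← Category.assoc]
      exact ofSpan_holds_self h k (x ≫ q)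

lemma IntRel.ofSpan_fst_snd {A B : C} (R : IntRel A B) : ofSpan R.fst R.snd = R :=
  ext_holds fun T a b => by
    rw [ofSpan_holds_of_jointly_mono _ _ fun _ _ _ => IntRel.hom_ext, holds_iff_exists]

lemma IntRel.ident_eq_ofSpan (A : C) : ident A = ofSpan (𝟙 A) (𝟙 A) :=
  ext_holds fun T a b => by
    rw [ofSpan_holds_of_jointly_mono _ _ fun _ _ _ h _ => by simpa using h, ident_holds]
    simp

lemma IntRel.graph_comp_graph {A B D : C} (f : A ⟶ B) (g : B ⟶ D) :
    comp (graph f) (graph g) = graph (f ≫ g) :=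
  ext_holds fun T a b => by
    rw [graph_comp_holds, graph_holds, graph_holds, Category.assoc]

end

lemma isRegularEpi_map_of_isEquivalence {D : Type u} [Category.{v} D] [HasPullbacks D]
    {D' : Type u'} [Category.{v'} D'] [HasPullbacks D'] (F : D ⥤ D') [F.IsEquivalence] {X Y : D}
    (f : X ⟶ Y) [IsRegularEpi f] : IsRegularEpi (F.map f) := by
  rw [isRegularEpi_iff_effectiveEpi]
  infer_instance

section

variable {D : Type u} [Category.{v} D] [Regular D] {D' : Type u'} [Category.{v'} D'] [Regular D']
  (F : D ⥤ D')

open IntRel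

/-- A span covers its image, and `F` preserves this cover, so passing to the image before applying
`F` changes nothing. -/
lemma IntRel.mapFunctor_ofSpan
    (hF : ∀ ⦃X Y : D⦄ (f : X ⟶ Y), IsRegularEpi f → IsRegularEpi (F.map f)) {X A B : D}
    (f : X ⟶ A) (g : X ⟶ B) : mapFunctor F (ofSpan f g) = ofSpan (F.map f) (F.map g) := by
  have h : (ofSpan f g).Holds f g := by simpa using ofSpan_holds_self f g (𝟙 X)
  have he := hF _ (isRegularEpi_lift_ofSpan f g h)
  unfold mapFunctor
  rw [← ofSpan_comp (F.map (lift f g h)), ← F.map_comp, ← F.map_comp, lift_fst, lift_snd]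

/-- A functor between regular categories that preserves pullbacks and regular epimorphisms acts
functorially on relations. -/
lemma isFunctorialOnRelations_of_preserves [PreservesLimitsOfShape WalkingCospan F]
    (hF : ∀ ⦃X Y : D⦄ (f : X ⟶ Y), IsRegularEpi f → IsRegularEpi (F.map f)) :
    IsFunctorialOnRelations F where
  map_ident A := by
    rw [ident_eq_ofSpan, mapFunctor_ofSpan F hF, F.map_id, ← ident_eq_ofSpan]
  map_comp A B E R S := by
    unfold comp
    rw [mapFunctor_ofSpan F hF, F.map_comp, F.map_comp]
    exact (comp_ofSpan ((IsPullback.of_hasPullback R.snd S.fst).map F)).symm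

variable [F.IsEquivalence]

lemma isFunctorialOnRelations_of_isEquivalence : IsFunctorialOnRelations F :=
  isFunctorialOnRelations_of_preserves F fun _ _ f _ => isRegularEpi_map_of_isEquivalence F f

lemma IntRel.mapFunctor_holds_map {A B : D} (R : IntRel A B) {T : D} (a : T ⟶ A) (b : T ⟶ B) :
    (mapFunctor F R).Holds (F.map a) (F.map b) ↔ R.Holds a b := by
  unfold mapFunctor
  rw [ofSpan_holds_of_jointly_mono, holds_iff_exists]
  · constructor
    · rintro ⟨x, h₁, h₂⟩
      obtain ⟨y, rfl⟩ := F.map_surjective x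
      rw [← F.map_comp] at h₁ h₂
      exact ⟨y, F.map_injective h₁, F.map_injective h₂⟩
    · rintro ⟨x, rfl, rfl⟩
      exact ⟨F.map x, by simp, by simp⟩
  · intro T x y h₁ h₂
    -- The legs remain jointly monic under `F`: test objects may be replaced by ones in the image of
    -- `F`, where fullness and faithfulness reduce the claim to `R`.
    let e := F.objObjPreimageIso T
    obtain ⟨x', hx⟩ := F.map_surjective (e.hom ≫ x)
    obtain ⟨y', hy⟩ := F.map_surjective (e.hom ≫ y)
    rw [← cancel_epi e.hom, ← hx, ← hy]
    congr 1
    refine IntRel.hom_ext ?_ ?_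
    · apply F.map_injective
      rw [F.map_comp, F.map_comp, hx, hy, Category.assoc, Category.assoc, h₁]
    · apply F.map_injective
      rw [F.map_comp, F.map_comp, hx, hy, Category.assoc, Category.assoc, h₂]

/-- An equivalence of regular categories induces an equivalence of categories of relations. -/
lemma relationFunctor_isEquivalence (h : IsFunctorialOnRelations F) :
    (relationFunctor F h).IsEquivalence where
  faithful := ⟨fun {A B R S} k => ext_holds fun T a b => by
    have k' : mapFunctor F R = mapFunctor F S := k
    rw [← mapFunctor_holds_map F, k', mapFunctor_holds_map F]⟩
  full := ⟨fun {A B} (Q : IntRel (F.obj A.of) (F.obj B.of)) => by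
    let e := F.objObjPreimageIso (Q : D')
    refine ⟨ofSpan (F.preimage (e.hom ≫ Q.fst)) (F.preimage (e.hom ≫ Q.snd)), ?_⟩
    refine (mapFunctor_ofSpan F (fun _ _ f _ => isRegularEpi_map_of_isEquivalence F f) _ _).trans ?_
    rw [F.map_preimage, F.map_preimage, ofSpan_comp, ofSpan_fst_snd]⟩
  essSurj := ⟨fun B => by
    let e := F.objObjPreimageIso B.of
    exact ⟨⟨F.objPreimage B.of⟩, ⟨⟨graph e.hom, graph e.inv,
      (graph_comp_graph e.hom e.inv).trans (congrArg graph e.hom_inv_id),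
      (graph_comp_graph e.inv e.hom).trans (congrArg graph e.inv_hom_id)⟩⟩⟩⟩

end

/-- Regularity is invariant under equivalences. -/
lemma regular_of_isEquivalence {D : Type u} [Category.{v} D] [Regular D] {D' : Type u'}
    [Category.{v'} D'] (G : D' ⥤ D) [G.IsEquivalence] : Regular D' :=
  have : HasFiniteLimits D' := ⟨fun _ _ _ => Adjunction.hasLimitsOfShape_of_equivalence G⟩
  { hasCoequalizer_of_isKernelPair := fun {X Y Z f g₁ g₂} h => by
      have h₁ : HasCoequalizer (G.map g₁) (G.map g₂) :=
        Regular.hasCoequalizer_of_isKernelPair (IsPullback.map G h)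
      have h₂ : HasColimit (parallelPair g₁ g₂ ⋙ G) :=
        hasColimit_of_iso (parallelPair.ext (Iso.refl _) (Iso.refl _) (by simp) (by simp) :
          parallelPair g₁ g₂ ⋙ G ≅ parallelPair (G.map g₁) (G.map g₂))
      exact Adjunction.hasColimit_of_comp_equivalence _ G
    regularEpiIsStableUnderBaseChange :=
      { of_isPullback := fun {_ _ _ _ f g f' g'} h hg => by
          have hg₁ : IsRegularEpi g := hg
          have hg₂ := isRegularEpi_map_of_isEquivalence G g
          have h₁ : IsRegularEpi (G.map g') :=
            Regular.regularEpiIsStableUnderBaseChange.of_isPullback (h.map G) hg₂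
          -- Applying the inverse functor gives an arrow isomorphic to `g'` through the unit of the
          -- equivalence.
          have h₂ := isRegularEpi_map_of_isEquivalence G.inv (G.map g')
          exact ((MorphismProperty.regularEpi D').arrow_mk_iso_iff
            ((Functor.mapArrowFunctor _ _).mapIso G.asEquivalence.unitIso |>.app (Arrow.mk g'))).2
              h₂ } }

/-! ### Internal categories in Mal'cev categories -/

section

variable {C : Type u} [Category.{v} C] [Regular C]

open IntRel

namespace InternalCategory

variable (D : InternalCategory C)

/-- `D.Mul a b c` says that `a` and `b` are composable, with composite `c`. -/
def Mul {T : C} (a b c : T ⟶ D.arr) : Prop :=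
  ∃ h : a ≫ D.src = b ≫ D.tgt, pullback.lift a b h ≫ D.m = c

variable {D} {T : C}

lemma Mul.unique {a b c c' : T ⟶ D.arr} (h : D.Mul a b c) (h' : D.Mul a b c') : c = c' := by
  obtain ⟨h, rfl⟩ := h
  obtain ⟨h', rfl⟩ := h'
  rfl

lemma Mul.assoc {a b c d e f : T ⟶ D.arr} (h₁ : D.Mul a b e) (h₂ : D.Mul e c d)
    (h₃ : D.Mul b c f) : D.Mul a f d := by
  obtain ⟨h₁, rfl⟩ := h₁
  obtain ⟨h₂, rfl⟩ := h₂
  obtain ⟨h₃, rfl⟩ := h₃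
  exact ⟨_, (D.assoc a b c h₁ h₃).symm⟩

lemma mul_comp (x : T ⟶ pullback D.src D.tgt) :
    D.Mul (x ≫ pullback.fst D.src D.tgt) (x ≫ pullback.snd D.src D.tgt) (x ≫ D.m) :=
  ⟨by simp [pullback.condition], by
    congr 1
    ext <;> simp⟩

lemma Mul.pull {a b c : T ⟶ D.arr} (h : D.Mul a b c) {T' : C} (p : T' ⟶ T) :
    D.Mul (p ≫ a) (p ≫ b) (p ≫ c) := by
  obtain ⟨h, rfl⟩ := h
  have k := mul_comp (p ≫ pullback.lift a b h)
  simpa using k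

lemma Mul.descend {a b c : T ⟶ D.arr} {T' : C} (p : T' ⟶ T) [IsRegularEpi p]
    (h : D.Mul (p ≫ a) (p ≫ b) (p ≫ c)) : D.Mul a b c := by
  obtain ⟨h, k⟩ := h
  have h' : a ≫ D.src = b ≫ D.tgt := by
    rw [← cancel_epi p]
    simpa using h
  refine ⟨h', ?_⟩
  rw [← cancel_epi p, ← k, ← Category.assoc]
  congr 1
  ext <;> simp

lemma idn_mul (a : T ⟶ D.arr) : D.Mul (a ≫ D.tgt ≫ D.idn) a a := by
  have h : D.Mul (D.tgt ≫ D.idn) (𝟙 D.arr) (𝟙 D.arr) := ⟨_, D.idn_m⟩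
  simpa using h.pull a

lemma mul_idn (a : T ⟶ D.arr) : D.Mul a (a ≫ D.src ≫ D.idn) a := by
  have h : D.Mul (𝟙 D.arr) (D.src ≫ D.idn) (𝟙 D.arr) := ⟨_, D.m_idn⟩
  simpa using h.pull a

lemma Mul.tgt_eq {a b c : T ⟶ D.arr} (h : D.Mul a b c) : c ≫ D.tgt = a ≫ D.tgt := by
  obtain ⟨h, rfl⟩ := h
  simp [D.m_tgt]

/-- A left inverse is equal to a right inverse. -/
lemma Mul.inv_unique {a c c' : T ⟶ D.arr} (h : D.Mul c a (a ≫ D.src ≫ D.idn))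
    (h' : D.Mul a c' (a ≫ D.tgt ≫ D.idn)) : c = c' := by
  have h₁ : a ≫ D.src ≫ D.idn = c' ≫ D.tgt ≫ D.idn := by
    have k := h.tgt_eq
    have k' := h'.1
    rw [← Category.assoc, k', Category.assoc]
  have h₂ : a ≫ D.tgt ≫ D.idn = c ≫ D.src ≫ D.idn := by
    rw [← Category.assoc, ← h.1, Category.assoc]
  have h₃ := h.assoc (h₁ ▸ idn_mul c') h'
  exact (mul_idn c).unique (h₂ ▸ h₃)

/-- The relation "`d = b c` for some `b`" between `c` and `d` is reflexive, hence symmetric. Since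
`a = a 1`, it relates `1` to `a`, so it also relates `a` to `1`: locally, some `c` satisfies `c a =
1`. -/
lemma exists_left_inverse (hC : IsMalcev C) (a : T ⟶ D.arr) :
    ∃ (T' : C) (p : T' ⟶ T) (_ : IsRegularEpi p) (c : T' ⟶ D.arr),
      D.Mul c (p ≫ a) (p ≫ a ≫ D.src ≫ D.idn) := by
  let R : IntRel D.arr D.arr := ofSpan (pullback.snd D.src D.tgt) D.m
  have hR {S : C} {b c d : S ⟶ D.arr} (h : D.Mul b c d) : R.Holds c d := by
    obtain ⟨h, rfl⟩ := h
    simpa using ofSpan_holds_self (pullback.snd D.src D.tgt) D.m (pullback.lift b c h)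
  have h₁ := ((hC R (hR (by simpa using idn_mul (𝟙 D.arr)))).1 _ _).1 (hR (mul_idn a))
  obtain ⟨T', p, hp, x, h₂, h₃⟩ := (ofSpan_holds _ _ _ _).1 h₁
  exact ⟨T', p, hp, x ≫ pullback.fst _ _, h₂ ▸ h₃ ▸ mul_comp x⟩

/-- Take a local left inverse `c` of the generic arrow and a local left inverse `d` of `c`. Then `d`
equals the generic arrow, so `c` is a two-sided inverse; being unique, it descends. -/
lemma exists_inverse (hC : IsMalcev C) (D : InternalCategory C) : ∃ i : D.arr ⟶ D.arr,
    D.Mul i (𝟙 _) (D.src ≫ D.idn) ∧ D.Mul (𝟙 _) i (D.tgt ≫ D.idn) := by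
  obtain ⟨T₁, p, hp, c, hc⟩ := exists_left_inverse hC (𝟙 D.arr)
  obtain ⟨T₂, q, hq, d, hd⟩ := exists_left_inverse hC c
  have hc' := hc.pull q
  simp only [Category.comp_id, Category.id_comp] at hc'
  have e₁ : p ≫ D.src ≫ D.idn = c ≫ D.tgt ≫ D.idn := by
    have k := hc.tgt_eq
    simp only [Category.id_comp, Category.assoc, D.idn_tgt, Category.comp_id] at k
    rw [← Category.assoc, k, Category.assoc]
  have e₂ : c ≫ D.src ≫ D.idn = p ≫ D.tgt ≫ D.idn := by
    rw [← Category.assoc, hc.1]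
    simp
  obtain rfl : d = q ≫ p := by
    refine Mul.inv_unique (a := q ≫ c) (by simpa using hd) ?_
    rw [Category.assoc, ← e₁]
    exact hc'
  have h₁ : D.Mul c p (p ≫ D.src ≫ D.idn) := by simpa using hc
  have h₂ : D.Mul p c (p ≫ D.tgt ≫ D.idn) := by
    refine Mul.descend q ?_
    rw [← e₂]
    simpa using hd
  obtain ⟨i, rfl⟩ := exists_descend p c fun W s t hst => by
    refine Mul.inv_unique (a := s ≫ p) (by simpa using h₁.pull s) ?_
    rw [hst]
    simpa using h₂.pull t
  exact ⟨i, Mul.descend p (by simpa using h₁), Mul.descend p (by simpa using h₂)⟩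

/-- Internal categories in a Mal'cev category are groupoids. -/
lemma exists_groupoid (hC : IsMalcev C) (D : InternalCategory C) :
    ∃ G : InternalGroupoid C, G.toInternalCategory = D := by
  obtain ⟨i, ⟨h₁, h₁'⟩, ⟨h₂, h₂'⟩⟩ := exists_inverse hC D
  rw [Category.id_comp] at h₁ h₂
  exact ⟨{ D with
    inv := i
    inv_src := h₁
    inv_tgt := h₂.symm
    inv_m := h₁'
    m_inv := h₂' }, rfl⟩

end InternalCategory

lemma IsMalcev.groupoidToCategory_isEquivalence (hC : IsMalcev C) :
    (groupoidToCategory C).IsEquivalence where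
  faithful := ⟨fun h => h⟩
  full := ⟨fun f => ⟨f, rfl⟩⟩
  essSurj := ⟨fun D => by
    obtain ⟨G, rfl⟩ := InternalCategory.exists_groupoid hC D
    exact ⟨G, ⟨Iso.refl _⟩⟩⟩

end

/-! ### Relations in the category of groupoids -/

section RegularCategory

variable {C : Type u} [Category.{v} C] [Regular C]

open IntRel InternalGroupoid

/-- The values on arrows of a pair of functors determine an arrow. -/
def JointlyMonoOnArr {K G H : InternalGroupoid C} (f : K ⟶ G) (g : K ⟶ H) : Prop :=
  ∀ ⦃T : C⦄ (x y : T ⟶ K.arr), x ≫ InternalFunctor.onArr f = y ≫ InternalFunctor.onArr f →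
    x ≫ InternalFunctor.onArr g = y ≫ InternalFunctor.onArr g → x = y

lemma src_idn_map {K G : InternalGroupoid C} (f : K ⟶ G) {T : C} (x : T ⟶ K.arr) :
    (x ≫ K.src ≫ K.idn) ≫ InternalFunctor.onArr f =
      (x ≫ InternalFunctor.onArr f) ≫ G.src ≫ G.idn := by
  rw [← Category.assoc x, idn_map, Category.assoc x, ← InternalFunctor.onArr_src f]
  simp

lemma tgt_idn_map {K G : InternalGroupoid C} (f : K ⟶ G) {T : C} (x : T ⟶ K.arr) :
    (x ≫ K.tgt ≫ K.idn) ≫ InternalFunctor.onArr f =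
      (x ≫ InternalFunctor.onArr f) ≫ G.tgt ≫ G.idn := by
  rw [← Category.assoc x, idn_map, Category.assoc x, ← InternalFunctor.onArr_tgt f]
  simp

/-- Composability of `x` and `y` is an equation between identity arrows of `K`, so it can be tested
after applying `f` and `g`. -/
lemma JointlyMonoOnArr.mul {K G H : InternalGroupoid C} {f : K ⟶ G} {g : K ⟶ H}
    (h : JointlyMonoOnArr f g) {T : C} {x y : T ⟶ K.arr} {c : T ⟶ G.arr} {d : T ⟶ H.arr}
    (h₁ : G.Mul (x ≫ InternalFunctor.onArr f) (y ≫ InternalFunctor.onArr f) c)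
    (h₂ : H.Mul (x ≫ InternalFunctor.onArr g) (y ≫ InternalFunctor.onArr g) d) :
    ∃ z, K.Mul x y z ∧ z ≫ InternalFunctor.onArr f = c ∧ z ≫ InternalFunctor.onArr g = d := by
  have e : x ≫ K.src ≫ K.idn = y ≫ K.tgt ≫ K.idn := by
    refine h _ _ ?_ ?_
    · rw [src_idn_map, tgt_idn_map, ← Category.assoc _ G.src, h₁.comp_eq, Category.assoc _ G.tgt]
    · rw [src_idn_map, tgt_idn_map, ← Category.assoc _ H.src, h₂.comp_eq, Category.assoc _ H.tgt]
  have e' := congrArg (· ≫ K.src) e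
  simp only [Category.assoc, K.idn_src, Category.comp_id] at e'
  obtain ⟨z, hz⟩ := exists_mul e'
  exact ⟨z, hz, (hz.map f).unique h₁, (hz.map g).unique h₂⟩

/-- The indiscrete groupoid on an object, in which there is a unique arrow between any two
elements. -/
def indiscretePresentation (A : C) : GroupoidPresentation C where
  obj := A
  arr := A ⨯ A
  src := prod.snd
  tgt := prod.fst
  idn := prod.lift (𝟙 A) (𝟙 A)
  inv := prod.lift prod.snd prod.fst
  Mul _ a b c := a ≫ prod.snd = b ≫ prod.fst ∧ c ≫ prod.fst = a ≫ prod.fst ∧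
    c ≫ prod.snd = b ≫ prod.snd
  idn_src := by simp
  idn_tgt := by simp
  mul_pull _ _ p _ _ _ h := by simp [h.1, h.2.1, h.2.2]
  mul_comp _ _ _ _ h := h.1
  mul_src _ _ _ _ h := h.2.2
  mul_tgt _ _ _ _ h := h.2.1
  mul_unique _ _ _ _ _ h h' :=
    Limits.prod.hom_ext (h.2.1.trans h'.2.1.symm) (h.2.2.trans h'.2.2.symm)
  exists_mul _ a b h := ⟨prod.lift (a ≫ prod.fst) (b ≫ prod.snd), h, by simp, by simp⟩
  idn_mul := by simp
  mul_idn := by simp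
  mul_assoc _ _ _ _ _ _ _ h₁ h₂ h₃ :=
    ⟨h₁.1.trans h₃.2.1.symm, h₂.2.1.trans h₁.2.1, h₂.2.2.trans h₃.2.2.symm⟩
  inv_mul := by simp
  mul_inv := by simp

/-- If the relations between groupoids that respect inverses are closed under composition then the
category is a Mal'cev category. -/
lemma isMalcev_of_isMultiplicative (h : ∀ ⦃G : InternalGroupoid C⦄ (R : IntRel G.arr G.arr),
    RespectsInverses G G R → IsMultiplicative R) : IsMalcev C := by
  refine isMalcev_of_transitive fun A S hr hs => ?_
  let P := indiscretePresentation A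
  -- The partial identity on the arrows `(a, b)` with `S(a, b)`. Inversion swaps the two components,
  -- so symmetry of `S` gives closure under inverses and reflexivity gives closure under identities;
  -- composition of `(a, b)` with `(b, c)` then expresses transitivity.
  let Q : IntRel (A ⨯ A) (A ⨯ A) := ofSpan S.arrow S.arrow
  have hQ {T : C} (a b : T ⟶ A ⨯ A) :
      Q.Holds a b ↔ a = b ∧ S.Holds (a ≫ prod.fst) (a ≫ prod.snd) := by
    rw [ofSpan_holds_of_jointly_mono _ _ fun _ _ _ k _ => (cancel_mono S.arrow).1 k]
    constructor
    · rintro ⟨x, rfl, rfl⟩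
      exact ⟨rfl, by simpa [IntRel.fst, IntRel.snd] using S.holds_comp x⟩
    · rintro ⟨rfl, k⟩
      exact ⟨lift _ _ k, by rw [lift_arrow, lift_eta], by rw [lift_arrow, lift_eta]⟩
  have hQ' : RespectsInverses P.toGroupoid P.toGroupoid Q := by
    intro T (a : T ⟶ A ⨯ A) (b : T ⟶ A ⨯ A) k
    obtain ⟨rfl, k'⟩ := (hQ a b).1 k
    exact ⟨(hQ (a ≫ prod.lift prod.snd prod.fst) _).2 ⟨rfl, by simpa using (hs _ _).1 k'⟩,
      (hQ (a ≫ prod.snd ≫ prod.lift (𝟙 A) (𝟙 A)) _).2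
        ⟨rfl, by simpa using Holds.pull hr (a ≫ prod.snd)⟩⟩
  intro T a b c hab hbc
  have hm : P.toGroupoid.Mul (prod.lift a b) (prod.lift b c) (prod.lift a c) :=
    (P.toGroupoid_mul _ _ _).2 (by simp [P, indiscretePresentation])
  have k := h Q hQ' hm hm ((hQ _ _).2 ⟨rfl, by simpa using hab⟩)
    ((hQ _ _).2 ⟨rfl, by simpa using hbc⟩)
  simpa using ((hQ _ _).1 k).2

variable {G H : InternalGroupoid C}

/-- Taking arrows preserves the monomorphism `R.arrow` and the product of `G` and `H`. So the
underlying relation needs no image, and its elements are found without passing to a cover. -/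
lemma jointlyMonoOnArr (R : IntRel G H) : JointlyMonoOnArr R.fst R.snd := by
  intro T x y h₁ h₂
  have : Mono ((groupoidArrows C).map R.arrow) := inferInstance
  refine (cancel_mono ((groupoidArrows C).map R.arrow)).1 ?_
  refine BinaryFan.IsLimit.hom_ext
    (isLimitOfHasBinaryProductOfPreservesLimit (groupoidArrows C) G H) ?_ ?_
  · exact (Category.assoc _ _ _).trans (h₁.trans (Category.assoc _ _ _).symm)
  · exact (Category.assoc _ _ _).trans (h₂.trans (Category.assoc _ _ _).symm)

lemma mapFunctor_groupoidArrows_holds (R : IntRel G H) {T : C} (a : T ⟶ G.arr) (b : T ⟶ H.arr) :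
    (mapFunctor (groupoidArrows C) R).Holds a b ↔
      ∃ x, x ≫ InternalFunctor.onArr R.fst = a ∧ x ≫ InternalFunctor.onArr R.snd = b :=
  ofSpan_holds_of_jointly_mono _ _ (jointlyMonoOnArr R) a b

/-- Composites are formed in the groupoid `R` itself. This is the property that relations coming
from `Gpd(C)` have, and that forces Mal'cev when all relations respecting inverses come from there.
-/
lemma isMultiplicative_mapFunctor (R : IntRel G H) :
    IsMultiplicative (G := G) (H := H) (mapFunctor (groupoidArrows C) R) := by
  intro T a a' a'' b b' b'' h₁ h₂ h h'
  obtain ⟨x, rfl, rfl⟩ := (mapFunctor_groupoidArrows_holds _ _ _).1 h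
  obtain ⟨y, rfl, rfl⟩ := (mapFunctor_groupoidArrows_holds _ _ _).1 h'
  obtain ⟨z, -, h₃, h₄⟩ := (jointlyMonoOnArr R).mul h₁ h₂
  exact (mapFunctor_groupoidArrows_holds _ _ _).2 ⟨z, h₃, h₄⟩

/-- The inclusion gives a lift on arrows. It preserves composition because its components in `G` and
`H` do and determine arrows of `S`, so it is a functor. -/
lemma le_of_mapFunctor_groupoidArrows_le {R S : IntRel G H}
    (h : mapFunctor (groupoidArrows C) R ≤ mapFunctor (groupoidArrows C) S) : R ≤ S := by
  refine IntRel.le_iff.2 fun T a b k => ?_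
  obtain ⟨x, rfl, rfl⟩ : ∃ x : T ⟶ (R : InternalGroupoid C), x ≫ R.fst = a ∧ x ≫ R.snd = b :=
    ⟨lift a b k, lift_fst a b k, lift_snd a b k⟩
  obtain ⟨y, h₁, h₂⟩ := (mapFunctor_groupoidArrows_holds S _ _).1
    (le_iff.1 h _ _ ((mapFunctor_groupoidArrows_holds R _ _).2
      ⟨InternalFunctor.onArr x, rfl, rfl⟩))
  have hy ⦃W : C⦄ (p q r : W ⟶ T.arr) (hp : T.Mul p q r) :
      (S : InternalGroupoid C).Mul (p ≫ y) (q ≫ y) (r ≫ y) := by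
    have k₁ := hp.map (x ≫ R.fst)
    have k₂ := hp.map (x ≫ R.snd)
    rw [comp_onArr, ← h₁] at k₁
    rw [comp_onArr, ← h₂] at k₂
    simp only [← Category.assoc] at k₁ k₂
    obtain ⟨z, hz, h₃, h₄⟩ := (jointlyMonoOnArr S).mul k₁ k₂
    rwa [jointlyMonoOnArr S _ _ h₃ h₄] at hz
  have e₁ : homOfMul y hy ≫ S.fst = x ≫ R.fst := InternalGroupoid.hom_ext h₁
  have e₂ : homOfMul y hy ≫ S.snd = x ≫ R.snd := InternalGroupoid.hom_ext h₂
  rw [← e₁, ← e₂]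
  exact S.holds_comp (homOfMul y hy)

variable [Regular (InternalGroupoid C)]

lemma IsMalcev.isFunctorialOnRelations_groupoidArrows (hC : IsMalcev C) :
    IsFunctorialOnRelations (groupoidArrows C) :=
  isFunctorialOnRelations_of_preserves (groupoidArrows C) fun _ _ f _ => hC.isRegularEpi_onArr f

/-- In a Mal'cev category, relations between groupoids are equivalent to relations respecting
inverses between their objects of morphisms. -/
lemma IsMalcev.forgetToInverseRel_isEquivalence
    (hC : IsMalcev C)
    (hU : IsFunctorialOnRelations (groupoidArrows C))
    (hU' : ∀ ⦃G H : InternalGroupoid C⦄ (R : IntRel G H),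
      RespectsInverses G H (mapFunctor (groupoidArrows C) R)) :
    (forgetToInverseRel C hU hU').IsEquivalence where
  faithful := ⟨fun {G H R S} h => by
    have h' : mapFunctor (groupoidArrows C) R = mapFunctor (groupoidArrows C) S :=
      congrArg InverseRelHom.rel h
    exact le_antisymm (α := IntRel G.of H.of) (le_of_mapFunctor_groupoidArrows_le h'.le)
      (le_of_mapFunctor_groupoidArrows_le h'.ge)⟩
  full := ⟨fun {G H} Q => by
    have hm := Q.respectsInverses.isMultiplicative hC
    refine ⟨ofSpan (relationFst Q.rel Q.respectsInverses hm)
      (relationSnd Q.rel Q.respectsInverses hm), InverseRelHom.ext ?_⟩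
    exact (mapFunctor_ofSpan (groupoidArrows C) (fun _ _ f _ => hC.isRegularEpi_onArr f) _ _).trans
      (ofSpan_fst_snd Q.rel)⟩
  essSurj := ⟨fun G => ⟨⟨G.of⟩, ⟨Iso.refl _⟩⟩⟩

end RegularCategory

end CPRel

end

/-! ### The main theorem -/

theorem mainTheorem1 (C : Type u) [Category.{v} C] [Regular C] :
    (CPRel.IsMalcev C → CPRel.IsPositivelyRegular C) ∧
    (CPRel.IsPositivelyRegular C →
      ∃ hE : ∀ ⦃G H : CPRel.InternalGroupoid C⦄ (R : CPRel.IntRel G.arr H.arr),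
          CPRel.RespectsInverses G H R →
            CPRel.IsCompletelyPositive G.toFrobenius H.toFrobenius R,
        (CPRel.inverseRelToCP C hE).IsEquivalence ∧
        (CPRel.IsMalcev C ↔
          ∃ (_ : Regular (CPRel.InternalGroupoid C)) (_ : Regular (CPRel.InternalCategory C))
            (hU : CPRel.IsFunctorialOnRelations (CPRel.groupoidArrows C))
            (hU' : ∀ ⦃G H : CPRel.InternalGroupoid C⦄ (R : CPRel.IntRel G H),
              CPRel.RespectsInverses G H (CPRel.IntRel.mapFunctor (CPRel.groupoidArrows C) R))
            (hV : CPRel.IsFunctorialOnRelations (CPRel.groupoidToCategory C)),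
            (CPRel.forgetToInverseRel C hU hU' ⋙ CPRel.inverseRelToCP C hE).IsEquivalence ∧
            (CPRel.relationFunctor (CPRel.groupoidToCategory C) hV).IsEquivalence)) := by
  refine ⟨CPRel.IsMalcev.isPositivelyRegular, fun hC => ?_⟩
  have hE : ∀ ⦃G H : CPRel.InternalGroupoid C⦄ (R : CPRel.IntRel G.arr H.arr),
      CPRel.RespectsInverses G H R → CPRel.IsCompletelyPositive G.toFrobenius H.toFrobenius R :=
    fun _ _ _ hR => hR.isCompletelyPositive hC
  have hE' := CPRel.inverseRelToCP_isEquivalence hE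
  refine ⟨hE, hE', fun hM => ?_, ?_⟩
  · have hG := hM.regular_internalGroupoid
    have hV := hM.groupoidToCategory_isEquivalence
    have hD : Regular (CPRel.InternalCategory C) :=
      CPRel.regular_of_isEquivalence (CPRel.groupoidToCategory C).inv
    have hU := hM.isFunctorialOnRelations_groupoidArrows
    have hU' : ∀ ⦃G H : CPRel.InternalGroupoid C⦄ (R : CPRel.IntRel G H),
        CPRel.RespectsInverses G H (CPRel.IntRel.mapFunctor (CPRel.groupoidArrows C) R) :=
      fun _ _ R => CPRel.respectsInverses_ofSpan R.fst R.snd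
    have hU'' := hM.forgetToInverseRel_isEquivalence hU hU'
    exact ⟨hG, hD, hU, hU', CPRel.isFunctorialOnRelations_of_isEquivalence _, inferInstance,
      CPRel.relationFunctor_isEquivalence _ _⟩
  · rintro ⟨hG, hD, hU, hU', hV, h, -⟩
    -- A relation `R` respecting inverses is completely positive, so fullness of `E ∘ U` exhibits it
    -- as the underlying relation of some `S` in `Gpd(C)`.
    refine CPRel.isMalcev_of_isMultiplicative fun G R hR => ?_
    let X : CPRel.RelationCat (CPRel.InternalGroupoid C) := ⟨G⟩
    let Q : (CPRel.forgetToInverseRel C hU hU' ⋙ CPRel.inverseRelToCP C hE).obj X ⟶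
        (CPRel.forgetToInverseRel C hU hU' ⋙ CPRel.inverseRelToCP C hE).obj X := ⟨R, hE R hR⟩
    obtain ⟨S, hS⟩ := h.full.map_surjective Q
    obtain rfl : CPRel.IntRel.mapFunctor (CPRel.groupoidArrows C) S = R :=
      congrArg CPRel.CPHom.rel hS
    exact CPRel.isMultiplicative_mapFunctor (G := G) (H := G) S
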